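/- \textbf{Setting.} For $x\in\mathbb R^2$ and $u\in\mathbb R_+^2=(0,\infty)^2$ let $B(x,u)=[x_1-\frac{u_1}2,x_1+\frac{u_1}2]\times[x_2-\frac{u_2}2,x_2+\frac{u_2}2]$. Let $\gamma_1\in(1,2)$ and $\gamma_2>\gamma_1$. Let $f_1,f_2\ge 0$ be measurable functions on $(0,\infty)$ such that $F(\mathrm du)=f_1(u_1)f_2(u_2)\,\mathrm du_1\,\mathrm du_2$ is a probability measure on $\mathbb R_+^2$, such that $f_i(t)\,t^{\gamma_i+1}\to 1$ as $t\to\infty$ for $i=1,2$, and such that, for some constant $c>0$, $f_1(t)\le c\,t^{-\gamma_1-1}$ for all $t>0$. For $\rho>0$ let $\lambda_\rho>0$, let $F_\rho$ be the image of $F$ under $u\mapsto\rho u$, and let $N_\rho$ be a Poisson random measure on $\mathbb R^2\times\mathbb R_+^2$ with intensity measure $\lambda_\rho\,\mathrm dx\,F_\rho(\mathrm du)$. For a finite signed measure $\mu$ on $\mathbb R^2$ put $$J_\rho(\mu)=\int\mu(B(x,u))\,N_\rho(\mathrm dx,\mathrm du),\qquad \widetilde J_\rho(\mu)=J_\rho(\mu)-\mathbb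 E J_\rho(\mu).$$ Let $\mathcal M_L$ be the set of finite signed measures $\mu$ on $\mathbb R^2$ that have a (Borel) density $f_\mu$ with respect to Lebesgue measure such that (a) there are $C_\mu,c_\mu>0$ with $|f_\mu(x)|\le C_\mu e^{-c_\mu(|x_1|+|x_2|)}$ for all $x\in\mathbb R^2$; (b) for all $x\in\mathbb R^2$ and $u_1>0$, as $\varepsilon\downarrow0$, $$\frac1\varepsilon\int_{B(x,(u_1,\varepsilon))}f_\mu(y)\,\mathrm dy\ \longrightarrow\ \int_{[x_1-\frac{u_1}2,\,x_1+\frac{u_1}2]}f_\mu(y_1,x_2)\,\mathrm dy_1 .$$ (The integrals on the right do not depend on the choice of a density satisfying (a) and (b).) Let $N_L$ be a Poisson random measure on $\mathbb R^2\times\mathbb R_+^2$ with intensity measure $n_L(\mathrm dx,\mathrm du)=\mathrm dx\,u_1^{-\gamma_1-1}\,\mathrm du_1\,f_2(u_2)\,\mathrm du_2$, let $\widetilde N_L=N_L-n_L$, and for $\mu\in\mathcal M_L$ let $$J_L(\mu)=\int_{\mathbb R^2\times\mathbb R_+^2}\Big(u_2\int_{[x_1-\frac{u_1}2,\,x_1+\frac{u_1}2]}f_\mu(y_1,x_2)\,\mathrm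 dy_1\Big)\widetilde N_L(\mathrm dx,\mathrm du).$$ Here the compensated integral $\int g\,\mathrm d\widetilde N_L$ is the limit in probability of $\int g_k\,\mathrm dN_L-\int g_k\,\mathrm dn_L$ for every sequence of bounded measurable $g_k$, vanishing outside sets of finite $n_L$-measure, with $|g_k|\le|g|$ and $g_k\to g$ pointwise. \textbf{Theorem (Poisson-lines scaling regime).} Suppose that $\lambda_\rho\rho^{\gamma_1}\to1$ as $\rho\downarrow0$ (so that $\lambda_\rho\to\infty$). Then: (i) for $\mu\in\mathcal M_L$ and $\rho>0$, the integral $J_\rho(\mu)$ exists almost surely and is integrable, so that $\widetilde J_\rho(\mu)$ is well defined; (ii) $\mathcal M_L$ is a linear space, the compensated integrals $J_L(\mu)$, $\mu\in\mathcal M_L$, exist, and $J_L(a\mu+b\nu)=aJ_L(\mu)+bJ_L(\nu)$ almost surely for all $\mu,\nu\in\mathcal M_L$ and $a,b\in\mathbb R$; (iii) as $\rho\downarrow0$, $\widetilde J_\rho(\cdot)/\rho$ converges to $J_L(\cdot)$ in finite-dimensional distributions on $\mathcal M_L$, that is, for all $m$ and $\mu_1,\dots,\mu_m\in\mathcal M_L$,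 $$\Big(\frac{\widetilde J_\rho(\mu_1)}\rho,\dots,\frac{\widetilde J_\rho(\mu_m)}\rho\Big)\ \longrightarrow\ \big(J_L(\mu_1),\dots,J_L(\mu_m)\big)\quad\text{in distribution.}$$ -/

import Mathlib

open MeasureTheory ProbabilityTheory Filter Set
open scoped Topology ENNReal Asymptotics

namespace RandomBoxes

noncomputable section

/-- The state space of a box: centre `z.1 ∈ ℝ²` and edge lengths `z.2`.  All intensity measures
below are concentrated on positive edge lengths. -/
abbrev BoxSpace : Type := (ℝ × ℝ) × (ℝ × ℝ)

/-! ### Poisson random measures -/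

/-- The Poisson law with parameter `r ∈ [0, ∞]`, on `[0, ∞]`; for `r = ∞` it is the unit mass
at `∞`. -/
def poissonLaw (r : ℝ≥0∞) : Measure ℝ≥0∞ :=
  if r = ∞ then Measure.dirac ∞
  else (poissonMeasure r.toNNReal).map (fun k : ℕ => (k : ℝ≥0∞))

/-- `N` is, under `P`, a Poisson random measure with intensity measure `n`: a random measure such
that `N(A)` has the Poisson law with parameter `n(A)` for every measurable `A`, and such that
`N(A₁), …, N(Aₖ)` are independent for pairwise disjoint measurable sets `A₁, …, Aₖ`. -/
structure IsPoissonRandomMeasure {Ω E : Type*} [MeasurableSpace Ω] [MeasurableSpace E]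
    (N : Ω → Measure E) (n : Measure E) (P : Measure Ω) : Prop where
  measurable : Measurable N
  law : ∀ A : Set E, MeasurableSet A → P.map (fun ω => N ω A) = poissonLaw (n A)
  indep : ∀ (k : ℕ) (A : Fin k → Set E), (∀ i, MeasurableSet (A i)) →
    Pairwise (fun i j => Disjoint (A i) (A j)) → iIndepFun (fun i ω => N ω (A i)) P

/-- `X` is a version of the compensated Poisson integral `∫ g d(N - n)`: for all bounded
measurable functions `gₖ`, vanishing outside sets of finite `n`-measure, with `|gₖ| ≤ |g|` and
`gₖ → g` pointwise, the elementary compensated integrals `∫ gₖ dN - ∫ gₖ dn` converge to `X` in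
probability. -/
def IsCompensatedIntegral {Ω E : Type*} [MeasurableSpace Ω] [MeasurableSpace E]
    (N : Ω → Measure E) (n : Measure E) (P : Measure Ω) (g : E → ℝ) (X : Ω → ℝ) : Prop :=
  Measurable g ∧ AEMeasurable X P ∧
    ∀ G : ℕ → E → ℝ, (∀ k, Measurable (G k)) → (∀ k, ∃ C : ℝ, ∀ z, |G k z| ≤ C) →
      (∀ k, n (Function.support (G k)) < ∞) → (∀ k z, |G k z| ≤ |g z|) →
      (∀ z, Tendsto (fun k => G k z) atTop (𝓝 (g z))) →
      TendstoInMeasure P (fun k ω => ∫ z, G k z ∂(N ω) - ∫ z, G k z ∂n) atTop X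

open scoped Classical in
/-- The compensated Poisson integral `∫ g d(N - n)` (a version of it, if it exists, and `0`
otherwise). -/
def compensatedIntegral {Ω E : Type*} [MeasurableSpace Ω] [MeasurableSpace E]
    (N : Ω → Measure E) (n : Measure E) (P : Measure Ω) (g : E → ℝ) : Ω → ℝ :=
  if h : ∃ X : Ω → ℝ, IsCompensatedIntegral N n P g X then h.choose else 0

/-! ### The random boxes model -/

/-- The closed box with centre `x` and edge lengths `u.1`, `u.2`. -/
def box (x u : ℝ × ℝ) : Set (ℝ × ℝ) :=
  Icc (x.1 - u.1 / 2) (x.1 + u.1 / 2) ×ˢ Icc (x.2 - u.2 / 2) (x.2 + u.2 / 2)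

/-- The measure `f(t) dt` on `(0, ∞)`. -/
def halfLineMeasure (f : ℝ → ℝ) : Measure ℝ :=
  (volume.restrict (Ioi 0)).withDensity (fun t => ENNReal.ofReal (f t))

/-- The measure `F(du) = f₁(u₁) f₂(u₂) du₁ du₂` on `(0, ∞)²`. -/
def edgeMeasure (f₁ f₂ : ℝ → ℝ) : Measure (ℝ × ℝ) :=
  (halfLineMeasure f₁).prod (halfLineMeasure f₂)

/-- The image `F_ρ` of `F` under `u ↦ ρ u`. -/
def scaledEdgeMeasure (f₁ f₂ : ℝ → ℝ) (ρ : ℝ) : Measure (ℝ × ℝ) :=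
  (edgeMeasure f₁ f₂).map (fun u => (ρ * u.1, ρ * u.2))

/-- The intensity measure `l dx F_ρ(du)` of the scaled random boxes model. -/
def boxIntensity (f₁ f₂ : ℝ → ℝ) (l ρ : ℝ) : Measure BoxSpace :=
  ENNReal.ofReal l • (volume : Measure (ℝ × ℝ)).prod (scaledEdgeMeasure f₁ f₂ ρ)

/-- The cumulative volume `J(μ) = ∫ μ(B(x,u)) N(dx, du)`. -/
def boxField {Ω : Type*} (N : Ω → Measure BoxSpace) (μ : SignedMeasure (ℝ × ℝ)) (ω : Ω) : ℝ :=
  ∫ z, μ (box z.1 z.2) ∂(N ω)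

/-- The centred field `J̃(μ) = J(μ) - E J(μ)`. -/
def centredBoxField {Ω : Type*} [MeasurableSpace Ω] (P : Measure Ω) (N : Ω → Measure BoxSpace)
    (μ : SignedMeasure (ℝ × ℝ)) (ω : Ω) : ℝ :=
  boxField N μ ω - ∫ ω', boxField N μ ω' ∂P

/-! ### The space of signed measures -/

/-- `f` is a density of `μ` that decays exponentially and whose averages over thin boxes
converge to its integrals over horizontal line segments. -/
structure IsLineDensity (μ : SignedMeasure (ℝ × ℝ)) (f : ℝ × ℝ → ℝ) : Prop where
  measurable : Measurable f
  eq_density : μ = (volume : Measure (ℝ × ℝ)).withDensityᵥ f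
  decay : ∃ C > 0, ∃ c > 0, ∀ x : ℝ × ℝ, |f x| ≤ C * Real.exp (-c * (|x.1| + |x.2|))
  tendsto_line : ∀ (x : ℝ × ℝ) (u₁ : ℝ), 0 < u₁ →
    Tendsto (fun ε : ℝ => 1 / ε * ∫ y in box x (u₁, ε), f y) (𝓝[>] 0)
      (𝓝 (∫ y₁ in Icc (x.1 - u₁ / 2) (x.1 + u₁ / 2), f (y₁, x.2)))

/-- The space `M_L` of signed measures. -/
def lineMeasures : Set (SignedMeasure (ℝ × ℝ)) :=
  {μ | ∃ f : ℝ × ℝ → ℝ, IsLineDensity μ f}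

open scoped Classical in
/-- The density `f_μ` of `μ ∈ M_L`.  Its integrals over horizontal line segments do not depend on
the choice, see `IsLineDensity.setIntegral_eq`. -/
def lineDensity (μ : SignedMeasure (ℝ × ℝ)) : ℝ × ℝ → ℝ :=
  if h : ∃ f : ℝ × ℝ → ℝ, IsLineDensity μ f then h.choose else 0

theorem IsLineDensity.integrable {μ : SignedMeasure (ℝ × ℝ)} {f : ℝ × ℝ → ℝ}
    (hf : IsLineDensity μ f) : Integrable f (volume : Measure (ℝ × ℝ)) := by
  obtain ⟨C, hC, c, hc, h⟩ := hf.decay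
  have h1 : Integrable (fun t : ℝ => Real.exp (-c * |t|)) := by
    rw [← integrableOn_univ, ← Iic_union_Ioi (a := (0 : ℝ)), integrableOn_union]
    constructor
    · refine (integrableOn_exp_mul_Iic hc 0).congr_fun (fun t ht => ?_) measurableSet_Iic
      simp only [abs_of_nonpos (mem_Iic.1 ht), neg_mul_neg]
    · refine (integrableOn_exp_mul_Ioi (neg_lt_zero.2 hc) 0).congr_fun (fun t ht => ?_)
        measurableSet_Ioi
      simp only [abs_of_pos (mem_Ioi.1 ht)]
  refine ((h1.mul_prod h1).const_mul C).mono' hf.measurable.aestronglyMeasurable ?_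
  filter_upwards with x
  rw [Real.norm_eq_abs, ← Real.exp_add, ← mul_add]
  exact h x

theorem IsLineDensity.setIntegral_eq {μ : SignedMeasure (ℝ × ℝ)} {f g : ℝ × ℝ → ℝ}
    (hf : IsLineDensity μ f) (hg : IsLineDensity μ g) (x : ℝ × ℝ) {u₁ : ℝ} (hu : 0 < u₁) :
    ∫ y₁ in Icc (x.1 - u₁ / 2) (x.1 + u₁ / 2), f (y₁, x.2)
      = ∫ y₁ in Icc (x.1 - u₁ / 2) (x.1 + u₁ / 2), g (y₁, x.2) := by
  have key : ∀ s : Set (ℝ × ℝ), MeasurableSet s → ∫ y in s, f y = ∫ y in s, g y := by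
    intro s hs
    rw [← withDensityᵥ_apply hf.integrable hs, ← withDensityᵥ_apply hg.integrable hs,
      ← hf.eq_density, ← hg.eq_density]
  have h := hg.tendsto_line x u₁ hu
  refine tendsto_nhds_unique (hf.tendsto_line x u₁ hu) (h.congr fun ε => ?_)
  rw [key (box x (u₁, ε)) (measurableSet_Icc.prod measurableSet_Icc)]

/-! ### The limiting field -/

/-- The kernel `u₂ ∫_{[x₁ - u₁/2, x₁ + u₁/2]} f_μ(y₁, x₂) dy₁`. -/
def lineKernel (μ : SignedMeasure (ℝ × ℝ)) (z : BoxSpace) : ℝ :=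
  z.2.2 * ∫ y₁ in Icc (z.1.1 - z.2.1 / 2) (z.1.1 + z.2.1 / 2), lineDensity μ (y₁, z.1.2)

/-- The intensity measure `n_L(dx, du) = dx u₁^{-γ₁-1} du₁ f₂(u₂) du₂`. -/
def lineIntensity (γ₁ : ℝ) (f₂ : ℝ → ℝ) : Measure BoxSpace :=
  (volume : Measure (ℝ × ℝ)).prod
    ((halfLineMeasure (fun t => 1 / t ^ (γ₁ + 1))).prod (halfLineMeasure f₂))

/-- The field `J_L(μ)` of compensated Poisson integrals, driven by `N`. -/
def lineField {Ω : Type*} [MeasurableSpace Ω] (γ₁ : ℝ) (f₂ : ℝ → ℝ) (P : Measure Ω)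
    (N : Ω → Measure BoxSpace) (μ : SignedMeasure (ℝ × ℝ)) : Ω → ℝ :=
  compensatedIntegral N (lineIntensity γ₁ f₂) P (lineKernel μ)

end

end RandomBoxes

open RandomBoxes

namespace RandomBoxes

/-! ### Integrals with respect to a Poisson random measure -/

/-! Both $\mu(B(x,u))$ and the limiting kernel are linear in $\mu$, so by the Cramér–Wold device
finite-dimensional convergence reduces to a single signed measure $\nu=\sum t_i\mu_i$, for which
characteristic functions are explicit. With $\Psi(x)=e^{ix}-1-ix$ (`levyKernel`), a compensated
Poisson integral of $g$ has characteristic function $\exp\int\Psi(tg)\,dn$. This is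
`IsPoissonRandomMeasure.charFun_map_integral_sub` for integrable $g$ and
`IsCompensatedIntegral.charFun_map` for $g\in L^p(n)$, $1\le p\le2$. What remains is the convergence
of exponents, `tendsto_integral_levyKernel_boxIntensity`.

For this, substitute $v=\rho u_1$ and leave $u_2$ unscaled. The prelimit intensity then becomes
$n_L$ with density $\lambda_\rho\rho^{\gamma_1}f_1(t)t^{\gamma_1+1}$, $t=v/\rho$, on boxes of size
$v\times\rho u_2$ (`boxIntensity_eq_map`). The density tends to 1 and is eventually bounded
uniformly in $v$ by the global bound on $f_1$. The boxes collapse to horizontal segments, so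
$\nu(B)/\rho$ tends to the kernel by the thin-box condition in `IsLineDensity`.

Dominated convergence uses $|\Psi(x)|\le2|x|^p$ with $\gamma_1<p<\min(2,\gamma_2)$ and the majorant
`lineBound`, a product of an exponential mass in $(x_1,u_1)$ and a multiple of $u_2/(1+|x_2|)$. Its
$p$-th power is $n_L$-integrable: small $u_1$ needs $p>\gamma_1$, large $u_1$ needs $\gamma_1>1$,
$x_2$ needs $p>1$, and $u_2$ needs $p<\gamma_2$.

The same integrability gives existence of $J_L$. A tail bound read off the characteristic function
makes the compensated integrals of an $L^p$-convergent sequence Cauchy in probability, with a limit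
independent of the sequence. -/

theorem lintegral_id_poissonLaw (r : ℝ≥0∞) : ∫⁻ x, x ∂(poissonLaw r) = r := by
  unfold poissonLaw
  split_ifs with h
  · simp [h]
  · lift r to NNReal using h
    rw [lintegral_map measurable_id' .of_discrete, ENNReal.toNNReal_coe, poissonMeasure,
      lintegral_sum_measure]
    simp only [lintegral_smul_measure, lintegral_dirac, smul_eq_mul]
    -- The term $k=0$ vanishes, and $k\,r^k/k!=r\cdot r^{k-1}/(k-1)!$ turns the shifted series into
    -- $r$ times the total mass.
    rw [tsum_eq_zero_add' ENNReal.summable]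
    have h1 : ∀ k : ℕ, ENNReal.ofReal (Real.exp (-r) * r ^ (k + 1) / (k + 1).factorial)
        * ((k + 1 : ℕ) : ℝ≥0∞)
        = r * ENNReal.ofReal (Real.exp (-r) * r ^ k / k.factorial) := by
      intro k
      rw [← ENNReal.ofReal_natCast, ← ENNReal.ofReal_coe_nnreal, ← ENNReal.ofReal_mul (by positivity),
        ← ENNReal.ofReal_mul (by positivity)]
      congr 1
      rw [Nat.factorial_succ]
      push_cast
      field_simp
      ring
    have h2 : ∑' k : ℕ, ENNReal.ofReal (Real.exp (-r) * r ^ k / k.factorial) = 1 := by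
      rw [← ENNReal.ofReal_tsum_of_nonneg (fun k => by positivity)
        (hasSum_one_poissonMeasure r).summable, (hasSum_one_poissonMeasure r).tsum_eq,
        ENNReal.ofReal_one]
    simp_rw [h1]
    rw [ENNReal.tsum_mul_left, h2]
    simp

theorem map_toReal_poissonLaw {r : ℝ≥0∞} (hr : r ≠ ∞) :
    (poissonLaw r).map ENNReal.toReal = (poissonMeasure r.toNNReal).map (fun k : ℕ => (k : ℝ)) := by
  rw [poissonLaw, if_neg hr, Measure.map_map ENNReal.measurable_toReal .of_discrete]
  congr 1

section PoissonRandomMeasure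

variable {Ω E : Type*} [MeasurableSpace Ω] [MeasurableSpace E] {N : Ω → Measure E}
  {n : Measure E} {P : Measure Ω}

theorem IsPoissonRandomMeasure.measurable_apply (hN : IsPoissonRandomMeasure N n P)
    {A : Set E} (hA : MeasurableSet A) : Measurable (fun ω => N ω A) :=
  (Measure.measurable_coe hA).comp hN.measurable

/-- Only the means $E\,N(A)=n(A)$ enter. In this form Campbell's formula for all nonnegative
functions is an instance of integration against a bind. -/
theorem IsPoissonRandomMeasure.bind_eq (hN : IsPoissonRandomMeasure N n P) : P.bind N = n := by
  ext A hA
  rw [Measure.bind_apply hA hN.measurable.aemeasurable, ← lintegral_id_poissonLaw (n A),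
    ← hN.law A hA, lintegral_map measurable_id' (hN.measurable_apply hA)]

theorem IsPoissonRandomMeasure.lintegral_lintegral (hN : IsPoissonRandomMeasure N n P)
    {h : E → ℝ≥0∞} (hh : Measurable h) : ∫⁻ ω, ∫⁻ z, h z ∂(N ω) ∂P = ∫⁻ z, h z ∂n := by
  rw [← Measure.lintegral_bind hN.measurable.aemeasurable hh.aemeasurable, hN.bind_eq]

theorem IsPoissonRandomMeasure.ae_integrable (hN : IsPoissonRandomMeasure N n P)
    {h : E → ℝ} (hm : Measurable h) (hh : Integrable h n) : ∀ᵐ ω ∂P, Integrable h (N ω) := by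
  have h1 : Measurable fun ω => ∫⁻ z, ‖h z‖ₑ ∂(N ω) :=
    (Measure.measurable_lintegral hm.enorm).comp hN.measurable
  have h2 : ∫⁻ ω, ∫⁻ z, ‖h z‖ₑ ∂(N ω) ∂P ≠ ∞ := by
    rw [hN.lintegral_lintegral hm.enorm]
    exact hh.2.ne
  filter_upwards [ae_lt_top h1 h2] with ω hω
  exact ⟨hm.aestronglyMeasurable, hω⟩

/-- Almost surely the Bochner integral is the difference of the Lebesgue integrals of the positive
and negative parts, and those are measurable in $\omega$. -/
theorem IsPoissonRandomMeasure.aemeasurable_integral (hN : IsPoissonRandomMeasure N n P)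
    {h : E → ℝ} (hm : Measurable h) (hh : Integrable h n) :
    AEMeasurable (fun ω => ∫ z, h z ∂(N ω)) P := by
  have h1 : Measurable fun ω => (∫⁻ z, ENNReal.ofReal (h z) ∂(N ω)).toReal
      - (∫⁻ z, ENNReal.ofReal (-h z) ∂(N ω)).toReal :=
    (((Measure.measurable_lintegral hm.ennreal_ofReal).comp hN.measurable).ennreal_toReal).sub
      ((Measure.measurable_lintegral hm.neg.ennreal_ofReal).comp hN.measurable).ennreal_toReal
  refine ⟨_, h1, ?_⟩
  filter_upwards [hN.ae_integrable hm hh] with ω hω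
  exact integral_eq_lintegral_pos_part_sub_lintegral_neg_part hω

theorem IsPoissonRandomMeasure.lintegral_enorm_integral_le (hN : IsPoissonRandomMeasure N n P)
    {h : E → ℝ} (hm : Measurable h) :
    ∫⁻ ω, ‖∫ z, h z ∂(N ω)‖ₑ ∂P ≤ ∫⁻ z, ‖h z‖ₑ ∂n := by
  rw [← hN.lintegral_lintegral hm.enorm]
  exact lintegral_mono fun ω => enorm_integral_le_lintegral_enorm _

theorem IsPoissonRandomMeasure.integrable_integral (hN : IsPoissonRandomMeasure N n P)
    {h : E → ℝ} (hm : Measurable h) (hh : Integrable h n) :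
    Integrable (fun ω => ∫ z, h z ∂(N ω)) P :=
  ⟨(hN.aemeasurable_integral hm hh).aestronglyMeasurable,
    (hN.lintegral_enorm_integral_le hm).trans_lt hh.2⟩

theorem IsPoissonRandomMeasure.integral_norm_integral_le (hN : IsPoissonRandomMeasure N n P)
    {h : E → ℝ} (hm : Measurable h) (hh : Integrable h n) :
    ∫ ω, ‖∫ z, h z ∂(N ω)‖ ∂P ≤ ∫ z, ‖h z‖ ∂n := by
  rw [integral_norm_eq_lintegral_enorm (hN.integrable_integral hm hh).1,
    integral_norm_eq_lintegral_enorm hh.1]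
  exact ENNReal.toReal_mono hh.2.ne (hN.lintegral_enorm_integral_le hm)

theorem IsPoissonRandomMeasure.integral_integral_of_nonneg (hN : IsPoissonRandomMeasure N n P)
    {h : E → ℝ} (hm : Measurable h) (hh : Integrable h n) (h0 : ∀ z, 0 ≤ h z) :
    ∫ ω, ∫ z, h z ∂(N ω) ∂P = ∫ z, h z ∂n := by
  rw [integral_eq_lintegral_of_nonneg_ae (ae_of_all _ fun ω => integral_nonneg h0)
    (hN.integrable_integral hm hh).1, integral_eq_lintegral_of_nonneg_ae (ae_of_all _ h0) hh.1,
    ← hN.lintegral_lintegral hm.ennreal_ofReal]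
  congr 1
  refine lintegral_congr_ae ?_
  filter_upwards [hN.ae_integrable hm hh] with ω hω
  rw [ofReal_integral_eq_lintegral_ofReal hω (ae_of_all _ h0)]

theorem IsPoissonRandomMeasure.integral_integral (hN : IsPoissonRandomMeasure N n P)
    {h : E → ℝ} (hm : Measurable h) (hh : Integrable h n) :
    ∫ ω, ∫ z, h z ∂(N ω) ∂P = ∫ z, h z ∂n := by
  have hp : Measurable fun z => max (h z) 0 := hm.max measurable_const
  have hq : Measurable fun z => max (-h z) 0 := hm.neg.max measurable_const
  have hd : ∀ z, h z = max (h z) 0 - max (-h z) 0 := fun z => (max_zero_sub_eq_self (h z)).symm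
  have e1 : ∀ᵐ ω ∂P, ∫ z, h z ∂(N ω) = ∫ z, max (h z) 0 ∂(N ω) - ∫ z, max (-h z) 0 ∂(N ω) := by
    filter_upwards [hN.ae_integrable hm hh] with ω hω
    rw [← integral_sub hω.pos_part hω.neg_part]
    exact integral_congr_ae (ae_of_all _ hd)
  rw [integral_congr_ae e1, integral_sub (hN.integrable_integral hp hh.pos_part)
    (hN.integrable_integral hq hh.neg_part),
    hN.integral_integral_of_nonneg hp hh.pos_part fun z => le_max_right _ _,
    hN.integral_integral_of_nonneg hq hh.neg_part fun z => le_max_right _ _,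
    ← integral_sub hh.pos_part hh.neg_part]
  exact (integral_congr_ae (ae_of_all _ hd)).symm

/-! ### Characteristic functions of Poisson integrals -/

theorem IsPoissonRandomMeasure.charFun_map_toReal (hN : IsPoissonRandomMeasure N n P)
    {A : Set E} (hA : MeasurableSet A) (hn : n A ≠ ∞) (t : ℝ) :
    charFun (P.map fun ω => (N ω A).toReal) t
      = Complex.exp ((n A).toReal * (Complex.exp (t * Complex.I) - 1)) := by
  have h1 : P.map (fun ω => (N ω A).toReal)
      = (poissonMeasure (n A).toNNReal).map (fun k : ℕ => (k : ℝ)) := by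
    rw [← map_toReal_poissonLaw hn, ← hN.law A hA,
      Measure.map_map ENNReal.measurable_toReal (hN.measurable_apply hA)]
    rfl
  rw [h1]
  exact charFun_map_cast_poissonMeasure _ t

theorem IsPoissonRandomMeasure.iIndepFun (hN : IsPoissonRandomMeasure N n P) {ι : Type*}
    [Fintype ι] {A : ι → Set E} (hA : ∀ i, MeasurableSet (A i))
    (hd : Pairwise fun i j => Disjoint (A i) (A j)) :
    ProbabilityTheory.iIndepFun (fun i ω => N ω (A i)) P := by
  have h := hN.indep (Fintype.card ι) (fun k => A ((Fintype.equivFin ι).symm k))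
    (fun k => hA _) (fun i j hij => hd fun h => hij ((Fintype.equivFin ι).symm.injective h))
  have h2 := h.precomp (g := Fintype.equivFin ι) (Fintype.equivFin ι).injective
  simp only [Equiv.symm_apply_apply] at h2
  exact h2

/-- The fibres of $\varphi$ are disjoint, so the integral is a linear combination of independent
Poisson variables and the characteristic functions multiply. -/
theorem IsPoissonRandomMeasure.charFun_map_integral_simpleFunc [IsProbabilityMeasure P]
    (hN : IsPoissonRandomMeasure N n P) (φ : SimpleFunc E ℝ) (hφ : Integrable φ n) :
    charFun (P.map fun ω => ∫ z, φ z ∂(N ω)) 1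
      = Complex.exp (∫ z, (Complex.exp (φ z * Complex.I) - 1) ∂n) := by
  classical
  have hfin := (SimpleFunc.integrable_iff (f := φ)).1 hφ
  have e1 : (fun ω => ∫ z, φ z ∂(N ω)) =ᵐ[P]
      fun ω => ∑ x : φ.range, (x : ℝ) * (N ω (φ ⁻¹' {(x : ℝ)})).toReal := by
    filter_upwards [hN.ae_integrable φ.measurable hφ] with ω hω
    rw [SimpleFunc.integral_eq_integral φ hω |>.symm, SimpleFunc.integral_eq]
    rw [← Finset.sum_coe_sort]
    refine Finset.sum_congr rfl fun x _ => ?_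
    rw [smul_eq_mul, mul_comm]
    rfl
  have hms : ∀ x : φ.range, MeasurableSet (φ ⁻¹' {(x : ℝ)}) := fun x => φ.measurableSet_fiber _
  have hind : ProbabilityTheory.iIndepFun
      (fun (x : φ.range) ω => (x : ℝ) * (N ω (φ ⁻¹' {(x : ℝ)})).toReal) P := by
    have h := hN.iIndepFun (A := fun x : φ.range => φ ⁻¹' {(x : ℝ)}) hms (fun x y hxy =>
      Disjoint.preimage _ (Set.disjoint_singleton.2 fun h => hxy (Subtype.ext h)))
    exact h.comp (fun x r => (x : ℝ) * r.toReal)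
      (fun x => measurable_const.mul ENNReal.measurable_toReal)
  rw [Measure.map_congr e1, hind.charFun_map_fun_sum_eq_prod (fun x =>
    ((hN.measurable_apply (hms x)).ennreal_toReal.const_mul _).aemeasurable), Finset.prod_apply]
  have e2 : ∀ x : φ.range,
      charFun (P.map fun ω => (x : ℝ) * (N ω (φ ⁻¹' {(x : ℝ)})).toReal) 1
      = Complex.exp ((n.real (φ ⁻¹' {(x : ℝ)}) : ℂ) * (Complex.exp ((x : ℝ) * Complex.I) - 1)) := by
    intro x
    rw [charFun_map_mul_comp (hN.measurable_apply (hms x)).ennreal_toReal.aemeasurable, mul_one]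
    -- The fibre over $0$ may have infinite measure, where the Poisson formula is unavailable; its
    -- coefficient $0$ makes the factor equal to 1.
    by_cases hx : (x : ℝ) = 0
    · have : IsProbabilityMeasure (P.map fun ω => (N ω (φ ⁻¹' {(x : ℝ)})).toReal) :=
        Measure.isProbabilityMeasure_map (hN.measurable_apply (hms x)).ennreal_toReal.aemeasurable
      rw [hx] at *
      simp
    · rw [hN.charFun_map_toReal (hms x) (hfin _ hx).ne]
      rfl
  rw [Finset.prod_congr rfl fun x _ => e2 x, ← Complex.exp_sum]
  congr 1
  have e3 := SimpleFunc.map_integral φ (fun x : ℝ => Complex.exp (x * Complex.I) - 1) hφ (by simp)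
  have hint : Integrable (φ.map fun x : ℝ => Complex.exp (x * Complex.I) - 1) n := by
    rw [SimpleFunc.integrable_iff_finMeasSupp]
    exact (SimpleFunc.integrable_iff_finMeasSupp.1 hφ).map (by simp)
  rw [SimpleFunc.integral_eq_integral _ hint] at e3
  simp only [SimpleFunc.map_apply] at e3
  rw [e3, ← Finset.sum_coe_sort φ.range]
  refine Finset.sum_congr rfl fun x _ => ?_
  rw [Complex.real_smul]

end PoissonRandomMeasure

end RandomBoxes

namespace RandomBoxes

noncomputable section

/-! ### The kernel of the compensated Lévy exponent -/

/-- The function `x ↦ exp (i x) - 1 - i x`. -/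
def levyKernel (x : ℝ) : ℂ := Complex.exp (x * Complex.I) - 1 - x * Complex.I

theorem continuous_levyKernel : Continuous levyKernel := by
  unfold levyKernel
  fun_prop

theorem levyKernel_zero : levyKernel 0 = 0 := by simp [levyKernel]

theorem norm_exp_mul_I_sub_one_le (x : ℝ) : ‖Complex.exp (x * Complex.I) - 1‖ ≤ |x| := by
  rw [mul_comm]
  exact Real.norm_exp_I_mul_ofReal_sub_one_le

theorem norm_exp_mul_I_sub_exp_mul_I_le (x y : ℝ) :
    ‖Complex.exp (x * Complex.I) - Complex.exp (y * Complex.I)‖ ≤ |x - y| := by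
  have h : Complex.exp (x * Complex.I) - Complex.exp (y * Complex.I)
      = Complex.exp (y * Complex.I) * (Complex.exp (((x - y : ℝ) : ℂ) * Complex.I) - 1) := by
    rw [mul_sub, ← Complex.exp_add]
    push_cast
    ring_nf
  rw [h, norm_mul, Complex.norm_exp_ofReal_mul_I, one_mul]
  exact norm_exp_mul_I_sub_one_le _

/-- Interpolates between the quadratic bound, used for $|x|\le1$ where $x^2\le|x|^p$, and the linear
bound, used for $|x|\ge1$ where $|x|\le|x|^p$. -/
theorem norm_levyKernel_le {p : ℝ} (hp1 : 1 ≤ p) (hp2 : p ≤ 2) (x : ℝ) :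
    ‖levyKernel x‖ ≤ 2 * |x| ^ p := by
  have hx : ‖(x : ℂ) * Complex.I‖ = |x| := by simp
  rcases le_total |x| 1 with h | h
  · have h1 : ‖levyKernel x‖ ≤ |x| ^ 2 := by
      rw [← hx] at h ⊢
      exact Complex.norm_exp_sub_one_sub_id_le h
    rcases eq_or_lt_of_le (abs_nonneg x) with h0 | h0
    · rw [abs_eq_zero.1 h0.symm, levyKernel_zero, norm_zero]
      positivity
    · have h2 : |x| ^ (2 : ℝ) ≤ |x| ^ p := Real.rpow_le_rpow_of_exponent_ge h0 h hp2
      rw [Real.rpow_two] at h2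
      have : 0 ≤ |x| ^ p := by positivity
      linarith
  · have h1 : ‖levyKernel x‖ ≤ |x| + |x| := by
      refine (norm_sub_le _ _).trans (add_le_add (norm_exp_mul_I_sub_one_le x) hx.le)
    have h2 := Real.rpow_le_rpow_of_exponent_le h hp1
    rw [Real.rpow_one] at h2
    linarith

theorem re_levyKernel_nonpos (x : ℝ) : (levyKernel x).re ≤ 0 := by
  simp only [levyKernel, Complex.sub_re, Complex.exp_ofReal_mul_I_re, Complex.one_re,
    Complex.re_ofReal_mul, Complex.I_re, mul_zero, sub_zero]
  linarith [Real.cos_le_one x]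

/-- The half-plane $\mathrm{Re}\le0$ is convex and $|\exp'|\le1$ on it, so the mean value inequality
applies between $w$ and $0$. -/
theorem norm_one_sub_exp_le {w : ℂ} (hw : w.re ≤ 0) : ‖1 - Complex.exp w‖ ≤ ‖w‖ := by
  have h := (convex_halfSpace_re_le 0).norm_image_sub_le_of_norm_deriv_le (𝕜 := ℂ)
    (f := Complex.exp) (C := 1) (fun z _ => Complex.differentiable_exp z)
    (fun z hz => by
      rw [Complex.deriv_exp, Complex.norm_exp]
      exact Real.exp_le_one_iff.2 hz) (x := w) (y := 0) hw (by simp)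
  simpa using h

/-! ### Characteristic functions and tails for integrable integrands -/

section PoissonRandomMeasure

variable {Ω E : Type*} [MeasurableSpace Ω] [MeasurableSpace E] {N : Ω → Measure E}
  {n : Measure E} {P : Measure Ω}

theorem integrable_exp_mul_I_sub_one {h : E → ℝ} (hh : Integrable h n) :
    Integrable (fun z => Complex.exp (h z * Complex.I) - 1) n := by
  refine hh.abs.mono' ?_ (ae_of_all _ fun z => norm_exp_mul_I_sub_one_le (h z))
  exact (Continuous.comp_aestronglyMeasurable (g := fun x : ℝ => Complex.exp (x * Complex.I) - 1)
    (by fun_prop) hh.1)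

theorem charFun_map_one {X : Ω → ℝ} (hX : AEMeasurable X P) (t : ℝ) :
    charFun (P.map X) t = ∫ ω, Complex.exp ((t * X ω : ℝ) * Complex.I) ∂P := by
  rw [charFun_apply_real, integral_map hX (by fun_prop)]
  simp

theorem norm_charFun_map_sub_le [IsProbabilityMeasure P] {X Y : Ω → ℝ} (hX : Integrable X P)
    (hY : Integrable Y P) :
    ‖charFun (P.map X) 1 - charFun (P.map Y) 1‖ ≤ ∫ ω, ‖X ω - Y ω‖ ∂P := by
  have hint : ∀ {Z : Ω → ℝ}, Integrable Z P →
      Integrable (fun ω => Complex.exp ((1 * Z ω : ℝ) * Complex.I)) P := by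
    intro Z hZ
    refine (integrable_const (1 : ℝ)).mono' ?_ (ae_of_all _ fun ω => ?_)
    · exact (Continuous.comp_aestronglyMeasurable
        (g := fun x : ℝ => Complex.exp ((1 * x : ℝ) * Complex.I)) (by fun_prop) hZ.1)
    · rw [Complex.norm_exp_ofReal_mul_I]
  rw [charFun_map_one hX.aemeasurable, charFun_map_one hY.aemeasurable,
    ← integral_sub (hint hX) (hint hY)]
  refine (norm_integral_le_integral_norm _).trans ?_
  refine integral_mono ((hint hX).sub (hint hY)).norm (hX.sub hY).norm fun ω => ?_
  have := norm_exp_mul_I_sub_exp_mul_I_le (1 * X ω) (1 * Y ω)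
  simpa using this

/-- Both sides are continuous for $L^1(n)$-convergence, as $x\mapsto e^{ix}$ is 1-Lipschitz and
Campbell's formula controls the random integrals; simple functions then suffice. Frequency 1 is
enough because $t$ can be absorbed into $h$. -/
theorem IsPoissonRandomMeasure.charFun_map_integral_one [IsProbabilityMeasure P]
    (hN : IsPoissonRandomMeasure N n P) {h : E → ℝ} (hm : Measurable h) (hh : Integrable h n) :
    charFun (P.map fun ω => ∫ z, h z ∂(N ω)) 1
      = Complex.exp (∫ z, (Complex.exp (h z * Complex.I) - 1) ∂n) := by
  let φ : ℕ → SimpleFunc E ℝ := fun k => SimpleFunc.approxOn h hm (range h ∪ {0}) 0 (by simp) k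
  have hφ : ∀ k, Integrable (φ k) n := fun k => SimpleFunc.integrable_approxOn_range hm hh k
  have hlim : Tendsto (fun k => ∫ z, ‖φ k z - h z‖ ∂n) atTop (𝓝 0) := by
    have h1 := SimpleFunc.tendsto_approxOn_range_L1_enorm hm hh
    have h2 := (ENNReal.tendsto_toReal ENNReal.zero_ne_top).comp h1
    rw [ENNReal.toReal_zero] at h2
    refine h2.congr fun k => ?_
    exact (integral_norm_eq_lintegral_enorm ((hφ k).sub hh).1).symm
  have hleft : Tendsto (fun k => charFun (P.map fun ω => ∫ z, φ k z ∂(N ω)) 1) atTop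
      (𝓝 (charFun (P.map fun ω => ∫ z, h z ∂(N ω)) 1)) := by
    rw [tendsto_iff_norm_sub_tendsto_zero]
    refine squeeze_zero (fun k => norm_nonneg _) (fun k => ?_) hlim
    refine (norm_charFun_map_sub_le (hN.integrable_integral (φ k).measurable (hφ k))
      (hN.integrable_integral hm hh)).trans ?_
    refine le_trans (le_of_eq ?_) (hN.integral_norm_integral_le ((φ k).measurable.sub hm)
      ((hφ k).sub hh))
    refine integral_congr_ae ?_
    filter_upwards [hN.ae_integrable (φ k).measurable (hφ k), hN.ae_integrable hm hh] with ω h1 h2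
    rw [← integral_sub h1 h2]
  have hright : Tendsto (fun k => Complex.exp (∫ z, (Complex.exp (φ k z * Complex.I) - 1) ∂n))
      atTop (𝓝 (Complex.exp (∫ z, (Complex.exp (h z * Complex.I) - 1) ∂n))) := by
    refine (Complex.continuous_exp.tendsto _).comp ?_
    rw [tendsto_iff_norm_sub_tendsto_zero]
    refine squeeze_zero (fun k => norm_nonneg _) (fun k => ?_) hlim
    rw [← integral_sub (integrable_exp_mul_I_sub_one (hφ k)) (integrable_exp_mul_I_sub_one hh)]
    refine (norm_integral_le_integral_norm _).trans ?_
    refine integral_mono ((integrable_exp_mul_I_sub_one (hφ k)).sub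
      (integrable_exp_mul_I_sub_one hh)).norm ((hφ k).sub hh).norm fun z => ?_
    simpa using norm_exp_mul_I_sub_exp_mul_I_le (φ k z) (h z)
  refine tendsto_nhds_unique hleft (hright.congr fun k => ?_)
  rw [hN.charFun_map_integral_simpleFunc (φ k) (hφ k)]

theorem integrable_levyKernel {h : E → ℝ} (hh : Integrable h n) :
    Integrable (fun z => levyKernel (h z)) n :=
  (integrable_exp_mul_I_sub_one hh).sub (hh.ofReal.mul_const _)

/-- The characteristic function of a compensated Poisson integral of an integrable function. -/
theorem IsPoissonRandomMeasure.charFun_map_integral_sub [IsProbabilityMeasure P]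
    (hN : IsPoissonRandomMeasure N n P) {h : E → ℝ} (hm : Measurable h) (hh : Integrable h n)
    (t : ℝ) :
    charFun (P.map fun ω => ∫ z, h z ∂(N ω) - ∫ z, h z ∂n) t
      = Complex.exp (∫ z, levyKernel (t * h z) ∂n) := by
  have hth := hh.const_mul t
  have h1 := hN.charFun_map_integral_one (hm.const_mul t) hth
  rw [charFun_map_one (hN.aemeasurable_integral (hm.const_mul t) hth)] at h1
  have hc : Integrable (fun z => ((t * h z : ℝ) : ℂ) * Complex.I) n := hth.ofReal.mul_const _
  have h2 : ∫ z, levyKernel (t * h z) ∂n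
      = ∫ z, (Complex.exp ((t * h z : ℝ) * Complex.I) - 1) ∂n
        - ((t * ∫ z, h z ∂n : ℝ) : ℂ) * Complex.I := by
    rw [← integral_const_mul, ← integral_complex_ofReal, ← integral_mul_const,
      ← integral_sub (integrable_exp_mul_I_sub_one hth) hc]
    rfl
  rw [h2, sub_eq_add_neg, Complex.exp_add, ← h1,
    charFun_map_one ((hN.aemeasurable_integral hm hh).sub_const _), ← integral_mul_const]
  refine integral_congr_ae (ae_of_all _ fun ω => ?_)
  simp only [integral_const_mul]
  rw [← Complex.exp_add]
  congr 1
  push_cast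
  ring

/-- A tail bound for compensated Poisson integrals. -/
theorem IsPoissonRandomMeasure.measureReal_lt_abs_integral_sub_le [IsProbabilityMeasure P]
    (hN : IsPoissonRandomMeasure N n P) {h : E → ℝ} (hm : Measurable h) (hh : Integrable h n)
    {p : ℝ} (hp1 : 1 ≤ p) (hp2 : p ≤ 2) (hhp : Integrable (fun z => |h z| ^ p) n)
    {r : ℝ} (hr : 0 < r) :
    P.real {ω | r < |∫ z, h z ∂(N ω) - ∫ z, h z ∂n|}
      ≤ 4 * (2 / r) ^ p * ∫ z, |h z| ^ p ∂n := by
  set X : Ω → ℝ := fun ω => ∫ z, h z ∂(N ω) - ∫ z, h z ∂n with hX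
  have hXm : AEMeasurable X P := (hN.aemeasurable_integral hm hh).sub_const _
  have : IsProbabilityMeasure (P.map X) := Measure.isProbabilityMeasure_map hXm
  have h0 : P.real {ω | r < |X ω|} = (P.map X).real {x | r < |x|} := by
    rw [measureReal_def, measureReal_def, Measure.map_apply_of_aemeasurable hXm
      (measurableSet_lt measurable_const measurable_id'.abs)]
    rfl
  -- The tail beyond $r$ is controlled by the mean of $1-\varphi$ over $|t|\le2/r$, where $\varphi$
  -- is the characteristic function. As the exponent has nonpositive real part, $|1-\varphi(t)|$ is
  -- at most its modulus.
  have key : ∀ t ∈ uIoc (-2 * r⁻¹) (2 * r⁻¹),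
      ‖1 - charFun (P.map X) t‖ ≤ 2 * (2 / r) ^ p * ∫ z, |h z| ^ p ∂n := by
    intro t ht
    have ht' : |t| ≤ 2 / r := by
      rw [uIoc_of_le (by have : 0 < r⁻¹ := by positivity
                         linarith)] at ht
      rw [div_eq_mul_inv]
      exact abs_le.2 ⟨by linarith [ht.1], ht.2⟩
    rw [hX, hN.charFun_map_integral_sub hm hh]
    refine (norm_one_sub_exp_le ?_).trans ?_
    · rw [← RCLike.re_eq_complex_re, ← integral_re (integrable_levyKernel (hh.const_mul t))]
      exact integral_nonpos fun z => re_levyKernel_nonpos _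
    · refine (norm_integral_le_integral_norm _).trans ?_
      rw [← integral_const_mul]
      refine integral_mono (integrable_levyKernel (hh.const_mul t)).norm (hhp.const_mul _)
        fun z => (norm_levyKernel_le hp1 hp2 _).trans ?_
      rw [abs_mul, Real.mul_rpow (abs_nonneg _) (abs_nonneg _), mul_assoc]
      gcongr
  rw [h0]
  refine (measureReal_abs_gt_le_integral_charFun hr).trans ?_
  have h1 := intervalIntegral.norm_integral_le_of_norm_le_const key
  calc 2⁻¹ * r * ‖∫ t in (-2 * r⁻¹)..(2 * r⁻¹), 1 - charFun (P.map X) t‖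
      ≤ 2⁻¹ * r * (2 * (2 / r) ^ p * (∫ z, |h z| ^ p ∂n) * |2 * r⁻¹ - -2 * r⁻¹|) := by gcongr
    _ = _ := by
      rw [abs_of_pos (by have : 0 < r⁻¹ := by positivity
                         linarith)]
      generalize (2 / r) ^ p = a
      field_simp
      ring

end PoissonRandomMeasure

end

end RandomBoxes

namespace RandomBoxes

/-! ### Convergence in probability -/

section InMeasure

variable {Ω : Type*} [MeasurableSpace Ω] {P : Measure Ω}

theorem tendstoInMeasure_linear_comb [IsFiniteMeasure P] {ι : Type*} {l : Filter ι}
    {X Y : ι → Ω → ℝ} {X' Y' : Ω → ℝ} (hX : TendstoInMeasure P X l X')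
    (hY : TendstoInMeasure P Y l Y') (a b : ℝ) :
    TendstoInMeasure P (fun k ω => a * X k ω + b * Y k ω) l (fun ω => a * X' ω + b * Y' ω) := by
  rw [tendstoInMeasure_iff_measureReal_norm] at *
  intro ε hε
  -- The summand 1 keeps $M$ positive when $a=b=0$.
  set M := |a| + |b| + 1 with hM
  have hM0 : 0 < M := by positivity
  have h := (hX (ε / (2 * M)) (by positivity)).add (hY (ε / (2 * M)) (by positivity))
  rw [add_zero] at h
  refine squeeze_zero (fun k => measureReal_nonneg) (fun k => ?_) h
  refine (measureReal_mono (fun ω hω => ?_)).trans (measureReal_union_le _ _)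
  by_contra hcon
  simp only [mem_union, mem_ofPred_eq, not_or, not_le, Real.norm_eq_abs] at hcon hω
  have h1 : |a * X k ω + b * Y k ω - (a * X' ω + b * Y' ω)|
      ≤ |a| * |X k ω - X' ω| + |b| * |Y k ω - Y' ω| := by
    rw [← abs_mul, ← abs_mul]
    refine le_trans (le_of_eq ?_) (abs_add_le _ _)
    congr 1
    ring
  have h2 : |a| * |X k ω - X' ω| ≤ M * |X k ω - X' ω| := by
    gcongr
    linarith [abs_nonneg b]
  have h3 : |b| * |Y k ω - Y' ω| ≤ M * |Y k ω - Y' ω| := by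
    gcongr
    linarith [abs_nonneg a]
  have h4 : M * |X k ω - X' ω| + M * |Y k ω - Y' ω| < ε := by
    have := mul_lt_mul_of_pos_left (add_lt_add hcon.1 hcon.2) hM0
    have e : M * (ε / (2 * M) + ε / (2 * M)) = ε := by field_simp; ring
    rw [e] at this
    linarith
  linarith

/-- A sequence that is Cauchy in probability converges in probability. -/
theorem exists_tendstoInMeasure_of_cauchy [IsFiniteMeasure P] {Y : ℕ → Ω → ℝ}
    (hm : ∀ k, AEMeasurable (Y k) P)
    (hc : ∀ ε > 0, ∀ δ > 0, ∃ K, ∀ k ≥ K, ∀ l ≥ K, P.real {ω | ε ≤ |Y k ω - Y l ω|} ≤ δ) :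
    ∃ X : Ω → ℝ, AEMeasurable X P ∧ TendstoInMeasure P Y atTop X := by
  -- Along this subsequence both the gaps and their exceptional probabilities are at most $2^{-j}$.
  -- Borel–Cantelli gives an almost sure limit, and the Cauchy property carries it to the whole
  -- sequence.
  obtain ⟨φ, hφ, hφ'⟩ := extraction_forall_of_eventually' (P := fun j K => ∀ k ≥ K, ∀ l ≥ K,
      P.real {ω | (1 / 2 : ℝ) ^ j ≤ |Y k ω - Y l ω|} ≤ (1 / 2) ^ j) (by
    intro j
    obtain ⟨K, hK⟩ := hc ((1 / 2) ^ j) (by positivity) ((1 / 2) ^ j) (by positivity)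
    exact ⟨K, fun K' hK' k hk l hl => hK k (hK'.trans hk) l (hK'.trans hl)⟩)
  have hsum : ∑' j, P {ω | (1 / 2 : ℝ) ^ j ≤ |Y (φ j) ω - Y (φ (j + 1)) ω|} ≠ ∞ := by
    have h1 : ∀ j, P {ω | (1 / 2 : ℝ) ^ j ≤ |Y (φ j) ω - Y (φ (j + 1)) ω|}
        ≤ ENNReal.ofReal ((1 / 2) ^ j) := fun j => by
      rw [← ofReal_measureReal]
      exact ENNReal.ofReal_le_ofReal
        (hφ' j (φ j) le_rfl (φ (j + 1)) (hφ.monotone (Nat.le_succ j)))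
    refine ((ENNReal.tsum_le_tsum h1).trans_lt ?_).ne
    rw [← ENNReal.ofReal_tsum_of_nonneg (fun j => by positivity) summable_geometric_two]
    exact ENNReal.ofReal_lt_top
  have hcau : ∀ᵐ ω ∂P, ∃ x, Tendsto (fun j => Y (φ j) ω) atTop (𝓝 x) := by
    filter_upwards [ae_eventually_notMem hsum] with ω hω
    obtain ⟨J, hJ⟩ := eventually_atTop.1 hω
    have h2 : CauchySeq (fun j => Y (φ (j + J)) ω) := by
      refine cauchySeq_of_le_geometric (1 / 2) 1 (by norm_num) fun j => ?_
      have h3 := hJ (j + J) (Nat.le_add_left _ _)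
      simp only [not_le] at h3
      rw [Real.dist_eq, show j + 1 + J = j + J + 1 by ring, one_mul]
      refine h3.le.trans ?_
      exact pow_le_pow_of_le_one (by norm_num) (by norm_num) (Nat.le_add_right _ _)
    obtain ⟨x, hx⟩ := cauchySeq_tendsto_of_complete h2
    exact ⟨x, (tendsto_add_atTop_iff_nat (f := fun j => Y (φ j) ω) J).1 hx⟩
  obtain ⟨X, hX, hXt⟩ := measurable_limit_of_tendsto_metrizable_ae
    (fun j => hm (φ j)) hcau
  refine ⟨X, hX.aemeasurable, ?_⟩
  have hsub := tendstoInMeasure_of_tendsto_ae (fun j => (hm (φ j)).aestronglyMeasurable) hXt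
  rw [tendstoInMeasure_iff_measureReal_norm] at hsub ⊢
  intro ε hε
  rw [Metric.tendsto_atTop]
  intro δ hδ
  obtain ⟨K, hK⟩ := hc (ε / 2) (by positivity) (δ / 2) (by positivity)
  obtain ⟨J, hJ⟩ := Metric.tendsto_atTop.1 (hsub (ε / 2) (by positivity)) (δ / 2) (by positivity)
  refine ⟨K, fun k hk => ?_⟩
  have h4 := hJ (max J K) (le_max_left _ _)
  have h5 := hK k hk (φ (max J K)) ((le_max_right J K).trans (hφ.le_apply))
  rw [Real.dist_eq, sub_zero, abs_of_nonneg measureReal_nonneg] at h4 ⊢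
  have h6 : P.real {ω | ε ≤ ‖Y k ω - X ω‖} ≤ P.real {ω | ε / 2 ≤ |Y k ω - Y (φ (max J K)) ω|}
      + P.real {ω | ε / 2 ≤ ‖Y (φ (max J K)) ω - X ω‖} := by
    refine (measureReal_mono (fun ω hω => ?_)).trans (measureReal_union_le _ _)
    by_contra hcon
    simp only [mem_union, mem_ofPred_eq, not_or, not_le, Real.norm_eq_abs] at hcon hω
    have := abs_sub_le (Y k ω) (Y (φ (max J K)) ω) (X ω)
    linarith [hcon.1, hcon.2]
  linarith

theorem tendsto_charFun_of_tendstoInMeasure [IsProbabilityMeasure P] {Y : ℕ → Ω → ℝ} {X : Ω → ℝ}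
    (hm : ∀ k, AEMeasurable (Y k) P) (h : TendstoInMeasure P Y atTop X) (t : ℝ) :
    Tendsto (fun k => charFun (P.map (Y k)) t) atTop (𝓝 (charFun (P.map X) t)) :=
  ProbabilityMeasure.tendsto_iff_tendsto_charFun.1 (h.tendstoInDistribution hm).tendsto t

end InMeasure

/-! ### Compensated Poisson integrals -/

theorem abs_sub_rpow_le {p : ℝ} (hp : 0 ≤ p) (a b : ℝ) :
    |a - b| ^ p ≤ 2 ^ p * (|a| ^ p + |b| ^ p) := by
  have h1 : |a - b| ≤ 2 * max |a| |b| := by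
    have := abs_sub a b
    linarith [le_max_left |a| |b|, le_max_right |a| |b|]
  refine (Real.rpow_le_rpow (abs_nonneg _) h1 hp).trans ?_
  rw [Real.mul_rpow (by norm_num) (by positivity)]
  gcongr
  rcases max_choice |a| |b| with h | h <;> rw [h]
  · linarith [Real.rpow_nonneg (abs_nonneg b) p]
  · linarith [Real.rpow_nonneg (abs_nonneg a) p]

/-- The functions `G k` are integrable and converge to `g` in `L^p`. -/
structure IsLpApproximation {E : Type*} [MeasurableSpace E] (n : Measure E) (p : ℝ) (g : E → ℝ)
    (G : ℕ → E → ℝ) : Prop where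
  measurable : ∀ k, Measurable (G k)
  integrable : ∀ k, Integrable (G k) n
  integrable_rpow : ∀ k, Integrable (fun z => |G k z - g z| ^ p) n
  tendsto : Tendsto (fun k => ∫ z, |G k z - g z| ^ p ∂n) atTop (𝓝 0)

section PoissonRandomMeasure

variable {Ω E : Type*} [MeasurableSpace Ω] [MeasurableSpace E] {N : Ω → Measure E}
  {n : Measure E} {P : Measure Ω} {p : ℝ} {g g' : E → ℝ} {G G' : ℕ → E → ℝ}

theorem integrable_abs_rpow_of_le {f₀ f : E → ℝ} (hp : 0 ≤ p) (hm : Measurable f)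
    (hf : Integrable (fun z => |f₀ z| ^ p) n) (h : ∀ z, |f z| ≤ |f₀ z|) :
    Integrable (fun z => |f z| ^ p) n := by
  refine hf.mono' (hm.abs.pow_const p).aestronglyMeasurable (ae_of_all _ fun z => ?_)
  rw [Real.norm_of_nonneg (by positivity)]
  exact Real.rpow_le_rpow (abs_nonneg _) (h z) hp

theorem integrable_abs_sub_rpow {f₀ f : E → ℝ} (hp : 0 ≤ p) (hm₀ : Measurable f₀)
    (hm : Measurable f) (h₀ : Integrable (fun z => |f₀ z| ^ p) n)
    (h : Integrable (fun z => |f z| ^ p) n) : Integrable (fun z => |f₀ z - f z| ^ p) n := by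
  refine ((h₀.add h).const_mul (2 ^ p)).mono'
    ((hm₀.sub hm).abs.pow_const p).aestronglyMeasurable (ae_of_all _ fun z => ?_)
  rw [Real.norm_of_nonneg (by positivity)]
  exact abs_sub_rpow_le hp _ _

/-- Links the sequences admitted in `IsCompensatedIntegral` to $L^p$: boundedness and support of
finite measure give integrability, domination by $|g|$ gives convergence. -/
theorem isLpApproximation_of_dominated (hp : 1 ≤ p) (hg : Measurable g)
    (hgp : Integrable (fun z => |g z| ^ p) n) (hG : ∀ k, Measurable (G k))
    (hb : ∀ k, ∃ C : ℝ, ∀ z, |G k z| ≤ C) (hs : ∀ k, n (Function.support (G k)) < ∞)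
    (hle : ∀ k z, |G k z| ≤ |g z|) (hlim : ∀ z, Tendsto (fun k => G k z) atTop (𝓝 (g z))) :
    IsLpApproximation n p g G where
  measurable := hG
  integrable k := by
    obtain ⟨C, hC⟩ := hb k
    rw [← integrableOn_iff_integrable_of_support_subset (Subset.refl (Function.support (G k)))]
    exact Measure.integrableOn_of_bounded (hs k).ne (hG k).aestronglyMeasurable
      (ae_of_all _ fun z => hC z)
  integrable_rpow k := integrable_abs_sub_rpow (by linarith) (hG k) hg
    (integrable_abs_rpow_of_le (by linarith) (hG k) hgp (hle k)) hgp
  tendsto := by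
    have h := tendsto_integral_of_dominated_convergence (μ := n)
      (F := fun k z => |G k z - g z| ^ p) (f := fun _ => (0 : ℝ))
      (fun z => 2 ^ p * (|g z| ^ p + |g z| ^ p))
      (fun k => (((hG k).sub hg).abs.pow_const p).aestronglyMeasurable)
      ((hgp.add hgp).const_mul _)
      (fun k => ae_of_all _ fun z => by
        rw [Real.norm_of_nonneg (by positivity)]
        refine (abs_sub_rpow_le (by linarith) _ _).trans ?_
        have := hle k z
        gcongr)
      (ae_of_all _ fun z => by
        have h1 : Tendsto (fun k => |G k z - g z|) atTop (𝓝 0) := by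
          have := ((hlim z).sub_const (g z)).abs
          simpa using this
        have h2 := h1.rpow_const (p := p) (Or.inr (by linarith))
        rwa [Real.zero_rpow (by linarith)] at h2)
    simpa using h

/-- The truncation of `g` to the values `x` with `1 / (k + 1) ≤ |x| ≤ k`. -/
noncomputable def truncation (g : E → ℝ) (k : ℕ) : E → ℝ :=
  {z | 1 / ((k : ℝ) + 1) ≤ |g z| ∧ |g z| ≤ k}.indicator g

theorem truncation_measurable (hg : Measurable g) (k : ℕ) : Measurable (truncation g k) :=
  hg.indicator ((measurableSet_le measurable_const hg.abs).inter
    (measurableSet_le hg.abs measurable_const))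

theorem abs_truncation_le {E : Type*} (g : E → ℝ) (k : ℕ) (z : E) : |truncation g k z| ≤ |g z| := by
  unfold truncation
  rw [indicator_apply]
  split_ifs <;> simp

theorem abs_truncation_le_natCast {E : Type*} (g : E → ℝ) (k : ℕ) (z : E) : |truncation g k z| ≤ k := by
  unfold truncation
  rw [indicator_apply]
  split_ifs with h
  · exact h.2
  · simp

/-- Chebyshev's inequality; this is the purpose of the lower cutoff in `truncation`. -/
theorem measure_support_truncation_lt_top (hp : 1 ≤ p) (hgp : Integrable (fun z => |g z| ^ p) n)
    (k : ℕ) : n (Function.support (truncation g k)) < ∞ := by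
  have h0 : (0 : ℝ) < 1 / ((k : ℝ) + 1) := by positivity
  refine (measure_mono ?_).trans_lt
    (hgp.measure_norm_ge_lt_top (ε := (1 / ((k : ℝ) + 1)) ^ p) (by positivity))
  intro z hz
  have hz' : z ∈ {z | 1 / ((k : ℝ) + 1) ≤ |g z| ∧ |g z| ≤ k} :=
    mem_of_indicator_ne_zero hz
  simp only [mem_ofPred_eq]
  rw [Real.norm_of_nonneg (by positivity)]
  exact Real.rpow_le_rpow h0.le hz'.1 (by linarith)

theorem tendsto_truncation {E : Type*} (g : E → ℝ) (z : E) :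
    Tendsto (fun k => truncation g k z) atTop (𝓝 (g z)) := by
  by_cases h : g z = 0
  · have : ∀ k, truncation g k z = g z := fun k => by
      unfold truncation
      rw [indicator_apply]
      split_ifs <;> simp [h]
    simp [this]
  · have h0 : 0 < |g z| := abs_pos.2 h
    have h1 := tendsto_one_div_add_atTop_nhds_zero_nat.eventually_le_const h0
    have h2 := tendsto_natCast_atTop_atTop.eventually_ge_atTop (|g z|)
    refine tendsto_const_nhds.congr' ?_
    filter_upwards [h1, h2] with k hk1 hk2
    exact (indicator_of_mem (s := {z | 1 / ((k : ℝ) + 1) ≤ |g z| ∧ |g z| ≤ k})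
      (show z ∈ _ from ⟨hk1, hk2⟩) g).symm

theorem isLpApproximation_truncation (hp : 1 ≤ p) (hg : Measurable g)
    (hgp : Integrable (fun z => |g z| ^ p) n) : IsLpApproximation n p g (truncation g) :=
  isLpApproximation_of_dominated hp hg hgp (truncation_measurable hg)
    (fun k => ⟨k, abs_truncation_le_natCast g k⟩) (measure_support_truncation_lt_top hp hgp)
    (abs_truncation_le g) (tendsto_truncation g)

theorem IsLpApproximation.integrable_sub (hG : IsLpApproximation n p g G)
    (hG' : IsLpApproximation n p g G') (hp : 0 ≤ p) (k l : ℕ) :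
    Integrable (fun z => |G k z - G' l z| ^ p) n := by
  refine (((hG.integrable_rpow k).add (hG'.integrable_rpow l)).const_mul (2 ^ p)).mono'
    (((hG.measurable k).sub (hG'.measurable l)).abs.pow_const p).aestronglyMeasurable
    (ae_of_all _ fun z => ?_)
  rw [Real.norm_of_nonneg (by positivity), ← sub_sub_sub_cancel_right _ _ (g z)]
  exact abs_sub_rpow_le hp _ _

theorem IsLpApproximation.integral_sub_le (hG : IsLpApproximation n p g G)
    (hG' : IsLpApproximation n p g G') (hp : 0 ≤ p) (k l : ℕ) :
    ∫ z, |G k z - G' l z| ^ p ∂n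
      ≤ 2 ^ p * (∫ z, |G k z - g z| ^ p ∂n + ∫ z, |G' l z - g z| ^ p ∂n) := by
  rw [← integral_add (hG.integrable_rpow k) (hG'.integrable_rpow l), ← integral_const_mul]
  refine integral_mono (hG.integrable_sub hG' hp k l)
    (((hG.integrable_rpow k).add (hG'.integrable_rpow l)).const_mul _) fun z => ?_
  simp only
  rw [← sub_sub_sub_cancel_right _ _ (g z)]
  exact abs_sub_rpow_le hp _ _

/-- Combinations of truncations of $g$ and $g'$ need not be dominated by $|ag+bg'|$, so they need
not be admissible in `IsCompensatedIntegral`. The $L^p$ notion is stable under combinations, which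
is what linearity of the integral requires. -/
theorem IsLpApproximation.linear_comb (hG : IsLpApproximation n p g G)
    (hG' : IsLpApproximation n p g' G') (hp : 0 ≤ p) (hg : Measurable g) (hg' : Measurable g')
    (a b : ℝ) :
    IsLpApproximation n p (fun z => a * g z + b * g' z) (fun k z => a * G k z + b * G' k z) := by
  have hle : ∀ k z, |a * G k z + b * G' k z - (a * g z + b * g' z)| ^ p
      ≤ 2 ^ p * (|a| ^ p * |G k z - g z| ^ p + |b| ^ p * |G' k z - g' z| ^ p) := fun k z => by
    have h := abs_sub_rpow_le hp (a * (G k z - g z)) (-(b * (G' k z - g' z)))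
    rw [abs_neg, abs_mul, abs_mul, Real.mul_rpow (abs_nonneg _) (abs_nonneg _),
      Real.mul_rpow (abs_nonneg _) (abs_nonneg _)] at h
    refine le_trans (le_of_eq ?_) h
    congr 2
    ring
  have hint : ∀ k, Integrable (fun z =>
      2 ^ p * (|a| ^ p * |G k z - g z| ^ p + |b| ^ p * |G' k z - g' z| ^ p)) n := fun k =>
    (((hG.integrable_rpow k).const_mul _).add ((hG'.integrable_rpow k).const_mul _)).const_mul _
  have hint' : ∀ k, Integrable
      (fun z => |a * G k z + b * G' k z - (a * g z + b * g' z)| ^ p) n := fun k => by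
    refine (hint k).mono' (Measurable.aestronglyMeasurable ?_) (ae_of_all _ fun z => ?_)
    · exact (((hG.measurable k).const_mul a).add ((hG'.measurable k).const_mul b) |>.sub
        ((hg.const_mul a).add (hg'.const_mul b))).abs.pow_const p
    · rw [Real.norm_of_nonneg (by positivity)]
      exact hle k z
  refine ⟨fun k => ((hG.measurable k).const_mul a).add ((hG'.measurable k).const_mul b),
    fun k => ((hG.integrable k).const_mul a).add ((hG'.integrable k).const_mul b), hint', ?_⟩
  have h0 : Tendsto (fun k => 2 ^ p * (|a| ^ p * ∫ z, |G k z - g z| ^ p ∂n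
      + |b| ^ p * ∫ z, |G' k z - g' z| ^ p ∂n)) atTop (𝓝 0) := by
    have := ((hG.tendsto.const_mul (|a| ^ p)).add (hG'.tendsto.const_mul (|b| ^ p))).const_mul
      (2 ^ p)
    simpa using this
  refine squeeze_zero (fun k => integral_nonneg fun z => by positivity) (fun k => ?_) h0
  refine (integral_mono (hint' k) (hint k) (hle k)).trans (le_of_eq ?_)
  rw [integral_const_mul, integral_add ((hG.integrable_rpow k).const_mul _)
    ((hG'.integrable_rpow k).const_mul _), integral_const_mul, integral_const_mul]

theorem IsPoissonRandomMeasure.aemeasurable_integral_sub (hN : IsPoissonRandomMeasure N n P)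
    {h : E → ℝ} (hm : Measurable h) (hh : Integrable h n) :
    AEMeasurable (fun ω => ∫ z, h z ∂(N ω) - ∫ z, h z ∂n) P :=
  (hN.aemeasurable_integral hm hh).sub_const _

theorem IsPoissonRandomMeasure.measureReal_le_abs_sub_le [IsProbabilityMeasure P]
    (hN : IsPoissonRandomMeasure N n P) (hp1 : 1 ≤ p) (hp2 : p ≤ 2)
    (hG : IsLpApproximation n p g G) (hG' : IsLpApproximation n p g G') {ε : ℝ} (hε : 0 < ε)
    (k l : ℕ) :
    P.real {ω | ε ≤ |(∫ z, G k z ∂(N ω) - ∫ z, G k z ∂n)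
        - (∫ z, G' l z ∂(N ω) - ∫ z, G' l z ∂n)|}
      ≤ 4 * (2 / (ε / 2)) ^ p
        * (2 ^ p * (∫ z, |G k z - g z| ^ p ∂n + ∫ z, |G' l z - g z| ^ p ∂n)) := by
  have hp0 : 0 ≤ p := by linarith
  refine le_trans ?_ ((hN.measureReal_lt_abs_integral_sub_le
    ((hG.measurable k).sub (hG'.measurable l)) ((hG.integrable k).sub (hG'.integrable l)) hp1 hp2
    -- The tail bound concerns a strict inequality, hence $\varepsilon/2$ in place of $\varepsilon$.
    (hG.integrable_sub hG' hp0 k l) (half_pos hε)).trans ?_)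
  · refine ENNReal.toReal_mono (measure_ne_top _ _) (measure_mono_ae ?_)
    filter_upwards [hN.ae_integrable (hG.measurable k) (hG.integrable k),
      hN.ae_integrable (hG'.measurable l) (hG'.integrable l)] with ω h1 h2 hω
    have hω' : ε ≤ |(∫ z, G k z ∂(N ω) - ∫ z, G k z ∂n)
        - (∫ z, G' l z ∂(N ω) - ∫ z, G' l z ∂n)| := hω
    show ε / 2 < |_|
    simp only [Pi.sub_apply]
    rw [integral_sub h1 h2, integral_sub (hG.integrable k) (hG'.integrable l),
      ← sub_sub_sub_comm]
    linarith
  · have := hG.integral_sub_le hG' hp0 k l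
    gcongr
    exact this

/-- The compensated Poisson integral of a function in `L^p`, `1 ≤ p ≤ 2`, exists as a limit in
probability along any approximating sequence. -/
theorem IsPoissonRandomMeasure.exists_tendstoInMeasure [IsProbabilityMeasure P]
    (hN : IsPoissonRandomMeasure N n P) (hp1 : 1 ≤ p) (hp2 : p ≤ 2)
    (hG : IsLpApproximation n p g G) :
    ∃ X : Ω → ℝ, AEMeasurable X P ∧
      TendstoInMeasure P (fun k ω => ∫ z, G k z ∂(N ω) - ∫ z, G k z ∂n) atTop X := by
  refine exists_tendstoInMeasure_of_cauchy
    (fun k => hN.aemeasurable_integral_sub (hG.measurable k) (hG.integrable k)) ?_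
  intro ε hε δ hδ
  set C := 4 * (2 / (ε / 2)) ^ p * 2 ^ p with hC
  have hC0 : 0 < C := by positivity
  obtain ⟨K, hK⟩ := eventually_atTop.1
    (hG.tendsto.eventually_le_const (show (0 : ℝ) < δ / (2 * C) by positivity))
  refine ⟨K, fun k hk l hl => (hN.measureReal_le_abs_sub_le hp1 hp2 hG hG hε k l).trans ?_⟩
  rw [← mul_assoc, ← hC]
  calc C * (∫ z, |G k z - g z| ^ p ∂n + ∫ z, |G l z - g z| ^ p ∂n)
      ≤ C * (δ / (2 * C) + δ / (2 * C)) := by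
        gcongr
        exacts [hK k hk, hK l hl]
    _ = δ := by field_simp; ring

/-- The tail bound applied to $G'_k-G_k$ shows that the two compensated integrals differ by a null
sequence in probability. -/
theorem IsPoissonRandomMeasure.tendstoInMeasure_congr [IsProbabilityMeasure P]
    (hN : IsPoissonRandomMeasure N n P) (hp1 : 1 ≤ p) (hp2 : p ≤ 2)
    (hG : IsLpApproximation n p g G) (hG' : IsLpApproximation n p g G') {X : Ω → ℝ}
    (hX : TendstoInMeasure P (fun k ω => ∫ z, G k z ∂(N ω) - ∫ z, G k z ∂n) atTop X) :
    TendstoInMeasure P (fun k ω => ∫ z, G' k z ∂(N ω) - ∫ z, G' k z ∂n) atTop X := by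
  have h0 : TendstoInMeasure P (fun k ω => (∫ z, G' k z ∂(N ω) - ∫ z, G' k z ∂n)
      - (∫ z, G k z ∂(N ω) - ∫ z, G k z ∂n)) atTop (fun _ => (0 : ℝ)) := by
    rw [tendstoInMeasure_iff_measureReal_norm]
    intro ε hε
    have h1 := ((hG'.tendsto.add hG.tendsto).const_mul (2 ^ p)).const_mul
      (4 * (2 / (ε / 2)) ^ p)
    simp only [add_zero, mul_zero] at h1
    refine squeeze_zero (fun k => measureReal_nonneg) (fun k => ?_) h1
    simp only [sub_zero, Real.norm_eq_abs]
    exact hN.measureReal_le_abs_sub_le hp1 hp2 hG' hG hε k k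
  have h := tendstoInMeasure_linear_comb hX h0 1 1
  simpa using h

theorem IsPoissonRandomMeasure.exists_isCompensatedIntegral [IsProbabilityMeasure P]
    (hN : IsPoissonRandomMeasure N n P) (hp1 : 1 ≤ p) (hp2 : p ≤ 2) (hg : Measurable g)
    (hgp : Integrable (fun z => |g z| ^ p) n) :
    ∃ X : Ω → ℝ, IsCompensatedIntegral N n P g X := by
  have hT := isLpApproximation_truncation hp1 hg hgp
  obtain ⟨X, hX, hXt⟩ := hN.exists_tendstoInMeasure hp1 hp2 hT
  exact ⟨X, hg, hX, fun G h1 h2 h3 h4 h5 => hN.tendstoInMeasure_congr hp1 hp2 hT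
    (isLpApproximation_of_dominated hp1 hg hgp h1 h2 h3 h4 h5) hXt⟩

theorem IsPoissonRandomMeasure.isCompensatedIntegral_compensatedIntegral [IsProbabilityMeasure P]
    (hN : IsPoissonRandomMeasure N n P) (hp1 : 1 ≤ p) (hp2 : p ≤ 2) (hg : Measurable g)
    (hgp : Integrable (fun z => |g z| ^ p) n) :
    IsCompensatedIntegral N n P g (compensatedIntegral N n P g) := by
  have h := hN.exists_isCompensatedIntegral hp1 hp2 hg hgp
  rw [compensatedIntegral, dif_pos h]
  exact h.choose_spec

/-- Extends the defining convergence from dominated sequences to all $L^p$ approximations, by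
comparison with the truncations. -/
theorem IsCompensatedIntegral.tendstoInMeasure [IsProbabilityMeasure P] {X : Ω → ℝ}
    (hX : IsCompensatedIntegral N n P g X) (hN : IsPoissonRandomMeasure N n P) (hp1 : 1 ≤ p)
    (hp2 : p ≤ 2) (hgp : Integrable (fun z => |g z| ^ p) n) (hG : IsLpApproximation n p g G) :
    TendstoInMeasure P (fun k ω => ∫ z, G k z ∂(N ω) - ∫ z, G k z ∂n) atTop X :=
  hN.tendstoInMeasure_congr hp1 hp2 (isLpApproximation_truncation hp1 hX.1 hgp) hG
    (hX.2.2 _ (truncation_measurable hX.1) (fun k => ⟨k, abs_truncation_le_natCast g k⟩)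
      (measure_support_truncation_lt_top hp1 hgp) (abs_truncation_le g) (tendsto_truncation g))

/-- Compensated Poisson integrals are linear in the integrand. -/
theorem IsCompensatedIntegral.linear_comb_ae_eq [IsProbabilityMeasure P] {X X' Y : Ω → ℝ}
    (hN : IsPoissonRandomMeasure N n P) (hp1 : 1 ≤ p) (hp2 : p ≤ 2) {a b : ℝ}
    (hX : IsCompensatedIntegral N n P g X) (hX' : IsCompensatedIntegral N n P g' X')
    (hgp : Integrable (fun z => |g z| ^ p) n) (hgp' : Integrable (fun z => |g' z| ^ p) n)
    (hY : IsCompensatedIntegral N n P (fun z => a * g z + b * g' z) Y)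
    (hYp : Integrable (fun z => |a * g z + b * g' z| ^ p) n) :
    Y =ᵐ[P] fun ω => a * X ω + b * X' ω := by
  have hT := isLpApproximation_truncation hp1 hX.1 hgp
  have hT' := isLpApproximation_truncation hp1 hX'.1 hgp'
  have h1 := hY.tendstoInMeasure hN hp1 hp2 hYp
    (hT.linear_comb hT' (by linarith) hX.1 hX'.1 a b)
  have h2 := tendstoInMeasure_linear_comb (hX.tendstoInMeasure hN hp1 hp2 hgp hT)
    (hX'.tendstoInMeasure hN hp1 hp2 hgp' hT') a b
  refine tendstoInMeasure_ae_unique h1 (h2.congr_left fun k => ?_)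
  filter_upwards [hN.ae_integrable (hT.measurable k) (hT.integrable k),
    hN.ae_integrable (hT'.measurable k) (hT'.integrable k)] with ω e1 e2
  rw [integral_add (e1.const_mul a) (e2.const_mul b),
    integral_add ((hT.integrable k).const_mul a) ((hT'.integrable k).const_mul b)]
  simp only [integral_const_mul]
  ring

/-- The characteristic function of a compensated Poisson integral. -/
theorem IsCompensatedIntegral.charFun_map [IsProbabilityMeasure P] {X : Ω → ℝ}
    (hX : IsCompensatedIntegral N n P g X) (hN : IsPoissonRandomMeasure N n P) (hp1 : 1 ≤ p)
    (hp2 : p ≤ 2) (hgp : Integrable (fun z => |g z| ^ p) n) (t : ℝ) :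
    charFun (P.map X) t = Complex.exp (∫ z, levyKernel (t * g z) ∂n) := by
  have hT := isLpApproximation_truncation hp1 hX.1 hgp
  have h1 := tendsto_charFun_of_tendstoInMeasure
    (fun k => hN.aemeasurable_integral_sub (hT.measurable k) (hT.integrable k))
    (hX.tendstoInMeasure hN hp1 hp2 hgp hT) t
  simp only [hN.charFun_map_integral_sub (hT.measurable _) (hT.integrable _)] at h1
  refine tendsto_nhds_unique h1 ((Complex.continuous_exp.tendsto _).comp ?_)
  refine tendsto_integral_of_dominated_convergence (fun z => 2 * (|t| ^ p * |g z| ^ p))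
    (fun k => ?_) ((hgp.const_mul _).const_mul _) (fun k => ae_of_all _ fun z => ?_)
    (ae_of_all _ fun z => ?_)
  · exact continuous_levyKernel.comp_aestronglyMeasurable
      ((hT.integrable k).const_mul t).aestronglyMeasurable
  · refine (norm_levyKernel_le hp1 hp2 _).trans ?_
    rw [abs_mul, Real.mul_rpow (abs_nonneg _) (abs_nonneg _)]
    have := abs_truncation_le g k z
    gcongr
  · exact (continuous_levyKernel.tendsto _).comp ((tendsto_truncation g z).const_mul t)

end PoissonRandomMeasure

end RandomBoxes

namespace RandomBoxes

noncomputable section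

/-! ### Exponential masses of intervals -/

/-- The mass of the interval of length `u` centred at `x` under `exp (-c |y|) dy`. -/
def expMass (c x u : ℝ) : ℝ := ∫ y in Icc (x - u / 2) (x + u / 2), Real.exp (-c * |y|)

theorem integrable_exp_neg_mul_abs {c : ℝ} (hc : 0 < c) :
    Integrable (fun t : ℝ => Real.exp (-c * |t|)) := by
  rw [← integrableOn_univ, ← Iic_union_Ioi (a := (0 : ℝ)), integrableOn_union]
  constructor
  · refine (integrableOn_exp_mul_Iic hc 0).congr_fun (fun t ht => ?_) measurableSet_Iic
    simp only [abs_of_nonpos (mem_Iic.1 ht), neg_mul_neg]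
  · refine (integrableOn_exp_mul_Ioi (neg_lt_zero.2 hc) 0).congr_fun (fun t ht => ?_)
      measurableSet_Ioi
    simp only [abs_of_pos (mem_Ioi.1 ht)]

/-- The total mass of `exp (-c |y|) dy`. -/
def expTotal (c : ℝ) : ℝ := ∫ y, Real.exp (-c * |y|)

theorem expTotal_nonneg (c : ℝ) : 0 ≤ expTotal c := integral_nonneg fun _ => (Real.exp_pos _).le

theorem expMass_nonneg (c x u : ℝ) : 0 ≤ expMass c x u :=
  integral_nonneg fun _ => (Real.exp_pos _).le

theorem expMass_le_expTotal {c : ℝ} (hc : 0 < c) (x u : ℝ) : expMass c x u ≤ expTotal c :=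
  setIntegral_le_integral (integrable_exp_neg_mul_abs hc) (ae_of_all _ fun _ => (Real.exp_pos _).le)

theorem volume_real_Icc_centred {x u : ℝ} (hu : 0 ≤ u) :
    volume.real (Icc (x - u / 2) (x + u / 2)) = u := by
  rw [Real.volume_real_Icc_of_le (by linarith)]
  ring

theorem expMass_le {c : ℝ} (hc : 0 < c) (x : ℝ) {u : ℝ} (hu : 0 ≤ u) : expMass c x u ≤ u := by
  have h : expMass c x u ≤ ∫ _ in Icc (x - u / 2) (x + u / 2), (1 : ℝ) := by
    refine setIntegral_mono (integrable_exp_neg_mul_abs hc).integrableOn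
      (by simp) fun y => Real.exp_le_one_iff.2 ?_
    have := abs_nonneg y
    nlinarith
  simpa [volume_real_Icc_centred hu] using h

theorem one_add_abs_mul_exp_le {c : ℝ} (hc : 0 < c) (y : ℝ) :
    (1 + |y|) * Real.exp (-c * |y|) ≤ 1 + 1 / c := by
  have h0 := abs_nonneg y
  have h1 : 1 + c * |y| ≤ Real.exp (c * |y|) := by linarith [Real.add_one_le_exp (c * |y|)]
  have h2 : 1 + |y| ≤ (1 + 1 / c) * (1 + c * |y|) := by
    have : (1 + 1 / c) * (1 + c * |y|) = 1 + |y| + (1 / c + c * |y|) := by field_simp; ring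
    have : 0 ≤ 1 / c + c * |y| := by positivity
    linarith
  rw [neg_mul, Real.exp_neg, ← div_eq_mul_inv, div_le_iff₀ (Real.exp_pos _)]
  refine h2.trans ?_
  gcongr

/-- A bound on the maximal function of `exp (-c |y|)`. -/
theorem expMass_le_maximal {c : ℝ} (hc : 0 < c) (x : ℝ) {u : ℝ} (hu : 0 ≤ u) :
    expMass c x u ≤ u * ((1 + 1 / c + expTotal c) / (1 + |x|)) := by
  have hx : 0 < 1 + |x| := by positivity
  rw [mul_div_assoc', le_div_iff₀ hx]
  have hexp := (integrable_exp_neg_mul_abs hc).integrableOn (s := Icc (x - u / 2) (x + u / 2))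
  -- On the interval $1+|x|\le(1+|y|)+u/2$. The first summand times $e^{-c|y|}$ is at most $1+1/c$;
  -- the second contributes at most $u/2$ times the total mass.
  have h1 : expMass c x u * (1 + |x|)
      ≤ ∫ y in Icc (x - u / 2) (x + u / 2), (1 + 1 / c + u / 2 * Real.exp (-c * |y|)) := by
    rw [expMass, ← integral_mul_const]
    refine setIntegral_mono_on (hexp.mul_const _) (Integrable.add (by simp) (hexp.const_mul _))
      measurableSet_Icc fun y hy => ?_
    have h2 : |x| ≤ |y| + u / 2 := by
      have h3 : |x - y| ≤ u / 2 := abs_le.2 ⟨by linarith [hy.2], by linarith [hy.1]⟩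
      have h4 := abs_sub_abs_le_abs_sub x y
      linarith
    have h5 := one_add_abs_mul_exp_le hc y
    have h6 := Real.exp_pos (-c * |y|)
    nlinarith
  refine h1.trans ?_
  rw [integral_add (by simp) (hexp.const_mul _), integral_const_mul]
  have h7 := expMass_le_expTotal hc x u
  have h8 := expTotal_nonneg c
  rw [expMass] at h7
  simp only [integral_const, measureReal_restrict_apply_univ, volume_real_Icc_centred hu,
    smul_eq_mul]
  nlinarith

theorem measurable_integral_Icc {α : Type*} [MeasurableSpace α] {f : α × ℝ → ℝ} (hf : Measurable f)
    {a b : α → ℝ} (ha : Measurable a) (hb : Measurable b) :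
    Measurable fun z => ∫ y in Icc (a z) (b z), f (z, y) := by
  have hs : MeasurableSet {q : α × ℝ | a q.1 ≤ q.2 ∧ q.2 ≤ b q.1} :=
    (measurableSet_le (ha.comp measurable_fst) measurable_snd).inter
      (measurableSet_le measurable_snd (hb.comp measurable_fst))
  have h := ((hf.indicator hs).stronglyMeasurable.integral_prod_right' (ν := volume)).measurable
  have e : (fun z => ∫ y in Icc (a z) (b z), f (z, y))
      = fun z => ∫ y, {q : α × ℝ | a q.1 ≤ q.2 ∧ q.2 ≤ b q.1}.indicator f (z, y) := by
    ext z
    rw [← integral_indicator measurableSet_Icc]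
    rfl
  rwa [e]

theorem measurable_expMass (c : ℝ) : Measurable fun q : ℝ × ℝ => expMass c q.1 q.2 :=
  measurable_integral_Icc (f := fun q : (ℝ × ℝ) × ℝ => Real.exp (-c * |q.2|)) (by fun_prop)
    (by fun_prop) (by fun_prop)

/-- Tonelli: for $u\ge0$ each point $y$ is covered by the intervals whose centres fill an interval
of length $u$. -/
theorem lintegral_expMass {c : ℝ} (hc : 0 < c) (u : ℝ) :
    ∫⁻ x, ENNReal.ofReal (expMass c x u) = ENNReal.ofReal u * ENNReal.ofReal (expTotal c) := by
  have hexp := integrable_exp_neg_mul_abs hc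
  have h0 : ∀ y : ℝ, 0 ≤ Real.exp (-c * |y|) := fun _ => (Real.exp_pos _).le
  have hm : Measurable fun y : ℝ => ENNReal.ofReal (Real.exp (-c * |y|)) := by fun_prop
  have hs : MeasurableSet {q : ℝ × ℝ | q.1 - u / 2 ≤ q.2 ∧ q.2 ≤ q.1 + u / 2} :=
    (measurableSet_le (by fun_prop) measurable_snd).inter
      (measurableSet_le measurable_snd (by fun_prop))
  have e1 : ∀ x, ENNReal.ofReal (expMass c x u)
      = ∫⁻ y, {q : ℝ × ℝ | q.1 - u / 2 ≤ q.2 ∧ q.2 ≤ q.1 + u / 2}.indicator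
          (fun q => ENNReal.ofReal (Real.exp (-c * |q.2|))) (x, y) := fun x => by
    rw [expMass, ofReal_integral_eq_lintegral_ofReal hexp.integrableOn (ae_of_all _ h0),
      ← lintegral_indicator measurableSet_Icc]
    rfl
  have e2 : ∀ y, ∫⁻ x, {q : ℝ × ℝ | q.1 - u / 2 ≤ q.2 ∧ q.2 ≤ q.1 + u / 2}.indicator
          (fun q => ENNReal.ofReal (Real.exp (-c * |q.2|))) (x, y)
      = ENNReal.ofReal u * ENNReal.ofReal (Real.exp (-c * |y|)) := fun y => by
    have : ∀ x, {q : ℝ × ℝ | q.1 - u / 2 ≤ q.2 ∧ q.2 ≤ q.1 + u / 2}.indicator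
          (fun q => ENNReal.ofReal (Real.exp (-c * |q.2|))) (x, y)
        = (Icc (y - u / 2) (y + u / 2)).indicator
          (fun _ => ENNReal.ofReal (Real.exp (-c * |y|))) x := fun x => by
      simp only [indicator_apply, mem_ofPred_eq, mem_Icc]
      congr 1
      exact propext ⟨fun h => ⟨by linarith [h.2], by linarith [h.1]⟩,
        fun h => ⟨by linarith [h.2], by linarith [h.1]⟩⟩
    simp_rw [this]
    rw [lintegral_indicator_const measurableSet_Icc, Real.volume_Icc, mul_comm]
    congr 2
    ring
  simp_rw [e1]
  rw [lintegral_lintegral_swap]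
  · simp_rw [e2]
    rw [lintegral_const_mul _ hm, expTotal, ofReal_integral_eq_lintegral_ofReal hexp
      (ae_of_all _ h0)]
  · exact ((hm.comp measurable_snd).indicator hs).aemeasurable

/-! ### Edge length measures -/

instance instSFiniteHalfLineMeasure (f : ℝ → ℝ) : SFinite (halfLineMeasure f) := by
  unfold halfLineMeasure
  infer_instance

theorem ae_halfLineMeasure_pos (f : ℝ → ℝ) : ∀ᵐ u ∂(halfLineMeasure f), 0 < u :=
  (withDensity_absolutelyContinuous _ _).ae_le (ae_restrict_mem measurableSet_Ioi)

theorem lintegral_halfLineMeasure {f : ℝ → ℝ} (hf : Measurable f) {g : ℝ → ℝ≥0∞}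
    (hg : Measurable g) :
    ∫⁻ u, g u ∂(halfLineMeasure f) = ∫⁻ u in Ioi 0, ENNReal.ofReal (f u) * g u := by
  rw [halfLineMeasure, lintegral_withDensity_eq_lintegral_mul _ hf.ennreal_ofReal hg]
  rfl

theorem setLIntegral_ofReal_lt_top {s : Set ℝ} {f : ℝ → ℝ} (h : IntegrableOn f s) :
    ∫⁻ u in s, ENNReal.ofReal (f u) < ∞ := h.lintegral_lt_top

/-- Moments of an edge length whose density is of order `u ^ (-γ - 1)` at infinity. -/
theorem lintegral_rpow_halfLineMeasure_lt_top {f : ℝ → ℝ} {γ q : ℝ} (hm : Measurable f)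
    (hfin : halfLineMeasure f univ < ∞) (hf : f ~[atTop] fun u => 1 / u ^ (γ + 1)) (hq : 0 ≤ q)
    (hqγ : q < γ) : ∫⁻ u, ENNReal.ofReal (u ^ q) ∂(halfLineMeasure f) < ∞ := by
  -- The constant 2 allows a relative error of 1 in the asymptotic equivalence.
  have hb : ∀ᶠ u in atTop, f u ≤ 2 / u ^ (γ + 1) := by
    filter_upwards [hf.isLittleO.bound (show (0 : ℝ) < 1 by norm_num), eventually_gt_atTop 0]
      with u hu h0
    have h1 : 0 < u ^ (γ + 1) := Real.rpow_pos_of_pos h0 _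
    simp only [Pi.sub_apply, one_mul] at hu
    rw [Real.norm_of_nonneg (by positivity : (0 : ℝ) ≤ 1 / u ^ (γ + 1)), Real.norm_eq_abs] at hu
    have h2 := (abs_le.1 hu).2
    have h3 : (2 : ℝ) / u ^ (γ + 1) = 1 / u ^ (γ + 1) + 1 / u ^ (γ + 1) := by ring
    linarith
  obtain ⟨R, hR⟩ := eventually_atTop.1 hb
  set S := max R 1 with hS
  have hS0 : 0 < S := lt_of_lt_of_le one_pos (le_max_right _ _)
  have hqm : Measurable fun u : ℝ => ENNReal.ofReal (u ^ q) := by fun_prop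
  rw [lintegral_halfLineMeasure hm hqm, ← Ioc_union_Ioi_eq_Ioi hS0.le]
  refine (lintegral_union_le _ _ _).trans_lt (ENNReal.add_lt_top.2 ⟨?_, ?_⟩)
  · calc ∫⁻ u in Ioc 0 S, ENNReal.ofReal (f u) * ENNReal.ofReal (u ^ q)
        ≤ ∫⁻ u in Ioc 0 S, ENNReal.ofReal (f u) * ENNReal.ofReal (S ^ q) := by
          refine setLIntegral_mono (by fun_prop) fun u hu => ?_
          gcongr
          exacts [hu.1.le, hu.2]
      _ ≤ ∫⁻ u in Ioi 0, ENNReal.ofReal (f u) * ENNReal.ofReal (S ^ q) :=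
          lintegral_mono_set Ioc_subset_Ioi_self
      _ = ENNReal.ofReal (S ^ q) * halfLineMeasure f univ := by
          rw [lintegral_mul_const _ hm.ennreal_ofReal, mul_comm]
          simp [halfLineMeasure]
      _ < ∞ := ENNReal.mul_lt_top ENNReal.ofReal_lt_top hfin
  · refine lt_of_le_of_lt (setLIntegral_mono (by fun_prop) fun u hu => ?_)
      (setLIntegral_ofReal_lt_top (f := fun u : ℝ => 2 * u ^ (q - γ - 1))
        ((integrableOn_Ioi_rpow_of_lt (by linarith) hS0).const_mul 2))
    have hu0 : 0 < u := hS0.trans hu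
    rw [← ENNReal.ofReal_mul' (by positivity)]
    refine ENNReal.ofReal_le_ofReal ?_
    have h1 := hR u ((le_max_left _ _).trans (le_of_lt hu))
    have h2 : 2 * u ^ (q - γ - 1) = 2 / u ^ (γ + 1) * u ^ q := by
      rw [show q - γ - 1 = q - (γ + 1) by ring, Real.rpow_sub hu0]
      ring
    rw [h2]
    gcongr

/-- Bound $p-1$ of the $p$ factors by $\min(u,K)$ and integrate the last one over $x$, which gives
$uK$. The remaining integrand $\min(u,K)^{p-1}u^{-\gamma}K$ is integrable at $0$ because $p>\gamma$
and at infinity because $\gamma>1$. -/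
theorem lintegral_expMass_rpow_lt_top {c γ p : ℝ} (hc : 0 < c) (hγ : 1 < γ) (hp : γ < p) :
    ∫⁻ x, ∫⁻ u, ENNReal.ofReal (expMass c x u ^ p)
      ∂(halfLineMeasure fun t => 1 / t ^ (γ + 1)) < ∞ := by
  have hm : Measurable fun q : ℝ × ℝ => ENNReal.ofReal (expMass c q.1 q.2 ^ p) :=
    ((measurable_expMass c).pow_const p).ennreal_ofReal
  set K := expTotal c
  have hK : 0 ≤ K := expTotal_nonneg c
  have hwm : Measurable fun t : ℝ => 1 / t ^ (γ + 1) := by fun_prop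
  have hbd : ∀ {u : ℝ}, 0 < u → ∀ x, ENNReal.ofReal (expMass c x u ^ p)
      ≤ ENNReal.ofReal (min u K ^ (p - 1)) * ENNReal.ofReal (expMass c x u) := fun {u} hu x => by
    have h0 := expMass_nonneg c x u
    have hmin : (0 : ℝ) ≤ min u K := le_min hu.le hK
    rw [← ENNReal.ofReal_mul (by positivity)]
    refine ENNReal.ofReal_le_ofReal ?_
    have h1 : expMass c x u ^ p = expMass c x u ^ (p - 1) * expMass c x u := by
      rcases h0.eq_or_lt with h | h
      · rw [← h, Real.zero_rpow (by linarith), mul_zero]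
      · rw [← Real.rpow_add_one h.ne', sub_add_cancel]
    rw [h1]
    gcongr
    · linarith
    · exact le_min (expMass_le hc x hu.le) (expMass_le_expTotal hc x u)
  rw [lintegral_lintegral_swap hm.aemeasurable]
  have h2 : ∫⁻ u, (∫⁻ x, ENNReal.ofReal (expMass c x u ^ p))
        ∂(halfLineMeasure fun t => 1 / t ^ (γ + 1))
      ≤ ∫⁻ u, ENNReal.ofReal (min u K ^ (p - 1)) * (ENNReal.ofReal u * ENNReal.ofReal K)
        ∂(halfLineMeasure fun t => 1 / t ^ (γ + 1)) := by
    refine lintegral_mono_ae ?_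
    filter_upwards [ae_halfLineMeasure_pos _] with u hu
    refine (lintegral_mono (hbd hu)).trans (le_of_eq ?_)
    have hx : Measurable fun x => ENNReal.ofReal (expMass c x u) :=
      ((measurable_expMass c).comp (measurable_id.prodMk measurable_const)).ennreal_ofReal
    rw [lintegral_const_mul _ hx, lintegral_expMass hc]
  refine h2.trans_lt ?_
  rw [lintegral_halfLineMeasure hwm (by fun_prop), ← Ioc_union_Ioi_eq_Ioi zero_le_one]
  have e : ∀ u : ℝ, 0 < u → ENNReal.ofReal (1 / u ^ (γ + 1))
      * (ENNReal.ofReal (min u K ^ (p - 1)) * (ENNReal.ofReal u * ENNReal.ofReal K))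
      = ENNReal.ofReal (min u K ^ (p - 1) * (u ^ (-γ) * K)) := fun u hu => by
    have hmin : (0 : ℝ) ≤ min u K := le_min hu.le hK
    rw [← ENNReal.ofReal_mul hu.le, ← ENNReal.ofReal_mul (by positivity),
      ← ENNReal.ofReal_mul (by positivity)]
    congr 1
    rw [Real.rpow_add_one hu.ne', Real.rpow_neg hu.le]
    field_simp
  refine (lintegral_union_le _ _ _).trans_lt (ENNReal.add_lt_top.2 ⟨?_, ?_⟩)
  · have hi : IntegrableOn (fun u : ℝ => u ^ (p - 1 - γ) * K) (Ioc 0 1) := by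
      have := (intervalIntegral.intervalIntegrable_rpow' (a := 0) (b := 1)
        (show -1 < p - 1 - γ by linarith))
      rw [intervalIntegrable_iff_integrableOn_Ioc_of_le zero_le_one] at this
      exact this.mul_const K
    refine lt_of_le_of_lt (setLIntegral_mono (by fun_prop) fun u hu => ?_)
      (setLIntegral_ofReal_lt_top hi)
    have hu0 : 0 < u := hu.1
    rw [e u hu0]
    refine ENNReal.ofReal_le_ofReal ?_
    rw [show p - 1 - γ = (p - 1) + (-γ) by ring, Real.rpow_add hu0, mul_assoc]
    have : (0 : ℝ) ≤ min u K := le_min hu0.le hK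
    gcongr
    · linarith
    · exact min_le_left _ _
  · have hi : IntegrableOn (fun u : ℝ => K ^ (p - 1) * (u ^ (-γ) * K)) (Ioi 1) :=
      ((integrableOn_Ioi_rpow_of_lt (by linarith) one_pos).mul_const K).const_mul _
    refine lt_of_le_of_lt (setLIntegral_mono (by fun_prop) fun u hu => ?_)
      (setLIntegral_ofReal_lt_top hi)
    have hu0 : 0 < u := one_pos.trans hu
    rw [e u hu0]
    refine ENNReal.ofReal_le_ofReal ?_
    have : (0 : ℝ) ≤ min u K := le_min hu0.le hK
    gcongr
    · linarith
    · exact min_le_right _ _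

theorem lintegral_expMass_halfLineMeasure_lt_top {f : ℝ → ℝ} {c ρ : ℝ} (hc : 0 < c) (hρ : 0 < ρ)
    (hf : ∫⁻ u, ENNReal.ofReal u ∂(halfLineMeasure f) < ∞) :
    ∫⁻ x, ∫⁻ u, ENNReal.ofReal (expMass c x u)
      ∂((halfLineMeasure f).map fun u => ρ * u) < ∞ := by
  rw [lintegral_lintegral_swap (measurable_expMass c).ennreal_ofReal.aemeasurable]
  simp_rw [lintegral_expMass hc]
  rw [lintegral_map (by fun_prop) (by fun_prop)]
  simp_rw [ENNReal.ofReal_mul hρ.le]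
  rw [lintegral_mul_const _ (by fun_prop), lintegral_const_mul _ (by fun_prop)]
  exact ENNReal.mul_lt_top (ENNReal.mul_lt_top ENNReal.ofReal_lt_top hf) ENNReal.ofReal_lt_top

/-- The measure pairs centres with centres and edges with edges, while the integrands factor by
coordinate direction; Tonelli regroups the four variables. -/
theorem lintegral_mul_boxSpace {a b : Measure ℝ} [SFinite a] [SFinite b] {F G : ℝ × ℝ → ℝ≥0∞}
    (hF : Measurable F) (hG : Measurable G) :
    ∫⁻ z : BoxSpace, F (z.1.1, z.2.1) * G (z.1.2, z.2.2)
        ∂((volume : Measure (ℝ × ℝ)).prod (a.prod b))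
      = (∫⁻ x, ∫⁻ u, F (x, u) ∂a) * ∫⁻ x, ∫⁻ u, G (x, u) ∂b := by
  rw [lintegral_prod _ (by fun_prop)]
  have h1 : ∀ x : ℝ × ℝ, ∫⁻ u : ℝ × ℝ, F (x.1, u.1) * G (x.2, u.2) ∂(a.prod b)
      = (∫⁻ u, F (x.1, u) ∂a) * ∫⁻ u, G (x.2, u) ∂b := fun x =>
    lintegral_prod_mul (f := fun u => F (x.1, u)) (g := fun u => G (x.2, u))
      (by fun_prop) (by fun_prop)
  simp only [h1]
  exact lintegral_prod_mul (μ := (volume : Measure ℝ)) (ν := volume)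
    (f := fun x => ∫⁻ u, F (x, u) ∂a) (g := fun x => ∫⁻ u, G (x, u) ∂b)
    hF.lintegral_prod_right'.aemeasurable hG.lintegral_prod_right'.aemeasurable

end

end RandomBoxes

namespace RandomBoxes

noncomputable section

/-! ### Measures with line densities -/

section LineDensity

variable {μ ν : SignedMeasure (ℝ × ℝ)} {f g : ℝ × ℝ → ℝ}

theorem measurableSet_box (x u : ℝ × ℝ) : MeasurableSet (box x u) :=
  measurableSet_Icc.prod measurableSet_Icc

theorem isLineDensity_lineDensity (hμ : μ ∈ lineMeasures) : IsLineDensity μ (lineDensity μ) := by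
  have h : ∃ f : ℝ × ℝ → ℝ, IsLineDensity μ f := hμ
  rw [lineDensity, dif_pos h]
  exact h.choose_spec

theorem IsLineDensity.apply_box (hf : IsLineDensity μ f) (x u : ℝ × ℝ) :
    μ (box x u) = ∫ y in box x u, f y := by
  conv_lhs => rw [hf.eq_density]
  exact withDensityᵥ_apply hf.integrable (measurableSet_box x u)

theorem IsLineDensity.integrableOn_line (hf : IsLineDensity μ f) (a b s : ℝ) :
    IntegrableOn (fun y => f (y, s)) (Icc a b) := by
  obtain ⟨C, hC, c, hc, h⟩ := hf.decay
  refine Measure.integrableOn_of_bounded (M := C) (by simp)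
    (hf.measurable.comp (measurable_id.prodMk measurable_const)).aestronglyMeasurable
    (ae_of_all _ fun y => (h _).trans ?_)
  have : Real.exp (-c * (|y| + |s|)) ≤ 1 := Real.exp_le_one_iff.2 (by
    have : 0 ≤ |y| + |s| := by positivity
    nlinarith)
  nlinarith

theorem IsLineDensity.linear_comb (hf : IsLineDensity μ f) (hg : IsLineDensity ν g) (a b : ℝ) :
    IsLineDensity (a • μ + b • ν) (fun x => a * f x + b * g x) where
  measurable := (hf.measurable.const_mul a).add (hg.measurable.const_mul b)
  eq_density := by
    have h := withDensityᵥ_add (hf.integrable.smul a) (hg.integrable.smul b)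
    rw [withDensityᵥ_smul, withDensityᵥ_smul, ← hf.eq_density, ← hg.eq_density] at h
    exact h.symm
  decay := by
    obtain ⟨C, hC, c, hc, h⟩ := hf.decay
    obtain ⟨D, hD, d, hd, h'⟩ := hg.decay
    -- The slower of the two decay rates serves both densities; the summand 1 keeps the constant
    -- positive when $a=b=0$.
    refine ⟨|a| * C + |b| * D + 1, by positivity, min c d, lt_min hc hd, fun x => ?_⟩
    have hx : 0 ≤ |x.1| + |x.2| := by positivity
    have e1 : Real.exp (-c * (|x.1| + |x.2|)) ≤ Real.exp (-min c d * (|x.1| + |x.2|)) := by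
      gcongr
      exact min_le_left _ _
    have e2 : Real.exp (-d * (|x.1| + |x.2|)) ≤ Real.exp (-min c d * (|x.1| + |x.2|)) := by
      gcongr
      exact min_le_right _ _
    have e3 := Real.exp_pos (-min c d * (|x.1| + |x.2|))
    calc |a * f x + b * g x| ≤ |a| * |f x| + |b| * |g x| := by
          rw [← abs_mul, ← abs_mul]
          exact abs_add_le _ _
      _ ≤ |a| * (C * Real.exp (-min c d * (|x.1| + |x.2|)))
          + |b| * (D * Real.exp (-min c d * (|x.1| + |x.2|))) := by
          gcongr
          · exact (h x).trans (by gcongr)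
          · exact (h' x).trans (by gcongr)
      _ ≤ _ := by linarith
  tendsto_line x u hu := by
    have h := ((hf.tendsto_line x u hu).const_mul a).add ((hg.tendsto_line x u hu).const_mul b)
    rw [integral_add ((hf.integrableOn_line _ _ _).const_mul a)
      ((hg.integrableOn_line _ _ _).const_mul b), integral_const_mul, integral_const_mul]
    refine h.congr fun ε => ?_
    rw [integral_add (hf.integrable.integrableOn.const_mul a)
      (hg.integrable.integrableOn.const_mul b), integral_const_mul, integral_const_mul]
    ring

theorem zero_mem_lineMeasures : (0 : SignedMeasure (ℝ × ℝ)) ∈ lineMeasures :=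
  ⟨0, measurable_const, withDensityᵥ_zero.symm, ⟨1, one_pos, 1, one_pos, fun x => by
    simpa using (Real.exp_pos _).le⟩, fun x u _ => by simp⟩

theorem linear_comb_mem_lineMeasures (hμ : μ ∈ lineMeasures) (hν : ν ∈ lineMeasures) (a b : ℝ) :
    a • μ + b • ν ∈ lineMeasures :=
  ⟨_, (isLineDensity_lineDensity hμ).linear_comb (isLineDensity_lineDensity hν) a b⟩

theorem IsLineDensity.lineKernel_eq (hf : IsLineDensity μ f) (z : BoxSpace) :
    lineKernel μ z
      = z.2.2 * ∫ y₁ in Icc (z.1.1 - z.2.1 / 2) (z.1.1 + z.2.1 / 2), f (y₁, z.1.2) := by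
  rw [lineKernel]
  rcases lt_or_ge 0 z.2.1 with h | h
  · rw [(isLineDensity_lineDensity ⟨f, hf⟩).setIntegral_eq hf z.1 h]
  -- Independence of the density is known only for positive lengths; otherwise the segment is a null
  -- set.
  · have h0 : volume (Icc (z.1.1 - z.2.1 / 2) (z.1.1 + z.2.1 / 2)) = 0 := by
      rw [Real.volume_Icc, ENNReal.ofReal_eq_zero]
      linarith
    rw [setIntegral_measure_zero _ h0, setIntegral_measure_zero _ h0]

theorem lineKernel_linear_comb (hμ : μ ∈ lineMeasures) (hν : ν ∈ lineMeasures) (a b : ℝ) :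
    lineKernel (a • μ + b • ν) = fun z => a * lineKernel μ z + b * lineKernel ν z := by
  ext z
  have hf := isLineDensity_lineDensity hμ
  have hg := isLineDensity_lineDensity hν
  rw [(hf.linear_comb hg a b).lineKernel_eq, lineKernel, lineKernel,
    integral_add ((hf.integrableOn_line _ _ _).const_mul a)
      ((hg.integrableOn_line _ _ _).const_mul b), integral_const_mul, integral_const_mul]
  ring

theorem measurable_lineKernel (hμ : μ ∈ lineMeasures) : Measurable (lineKernel μ) := by
  have hf := (isLineDensity_lineDensity hμ).measurable
  refine Measurable.mul (by fun_prop) ?_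
  exact measurable_integral_Icc (α := BoxSpace)
    (f := fun q : BoxSpace × ℝ => lineDensity μ (q.2, q.1.1.2))
    (hf.comp (by fun_prop)) (by fun_prop) (by fun_prop)

theorem measurable_apply_box (hμ : μ ∈ lineMeasures) :
    Measurable fun z : BoxSpace => μ (box z.1 z.2) := by
  have hf := isLineDensity_lineDensity hμ
  have hs : MeasurableSet {q : BoxSpace × (ℝ × ℝ) | q.2 ∈ box q.1.1 q.1.2} := by
    simp only [box, mem_prod, mem_Icc, ofPred_and]
    refine ((measurableSet_le ?_ ?_).inter (measurableSet_le ?_ ?_)).inter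
      ((measurableSet_le ?_ ?_).inter (measurableSet_le ?_ ?_)) <;> fun_prop
  have h := (((hf.measurable.comp measurable_snd).indicator hs).stronglyMeasurable.integral_prod_right'
    (ν := volume)).measurable
  have e : (fun z : BoxSpace => μ (box z.1 z.2)) = fun z => ∫ y,
      {q : BoxSpace × (ℝ × ℝ) | q.2 ∈ box q.1.1 q.1.2}.indicator
        (lineDensity μ ∘ Prod.snd) (z, y) := by
    ext z
    rw [hf.apply_box, ← integral_indicator (measurableSet_box _ _)]
    rfl
  rwa [e]

theorem abs_apply_box_le (hf : IsLineDensity μ f) {C c : ℝ} (hc : 0 < c)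
    (h : ∀ x : ℝ × ℝ, |f x| ≤ C * Real.exp (-c * (|x.1| + |x.2|))) (x u : ℝ × ℝ) :
    |μ (box x u)| ≤ C * (expMass c x.1 u.1 * expMass c x.2 u.2) := by
  have hi := integrable_exp_neg_mul_abs hc
  rw [hf.apply_box, expMass, expMass, ← setIntegral_prod_mul, ← integral_const_mul,
    ← Measure.volume_eq_prod]
  refine (abs_integral_le_integral_abs).trans ?_
  refine setIntegral_mono hf.integrable.abs.integrableOn ?_ fun y => ?_
  · exact ((hi.mul_prod hi).const_mul C).integrableOn
  · rw [← Real.exp_add, ← mul_add]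
    exact h y

/-- The factor $e^{-c|x_2|}$ is weakened to a multiple of $1/(1+|x_2|)$ so that the majorant of the
thin-box masses also dominates the limit. -/
theorem abs_lineKernel_le (hf : IsLineDensity μ f) {C c : ℝ} (hC : 0 < C) (hc : 0 < c)
    (h : ∀ x : ℝ × ℝ, |f x| ≤ C * Real.exp (-c * (|x.1| + |x.2|))) {z : BoxSpace}
    (hz : 0 ≤ z.2.2) :
    |lineKernel μ z| ≤ C * (expMass c z.1.1 z.2.1
      * (z.2.2 * ((1 + 1 / c + expTotal c) / (1 + |z.1.2|)))) := by
  have hi := integrable_exp_neg_mul_abs hc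
  have h1 : |∫ y in Icc (z.1.1 - z.2.1 / 2) (z.1.1 + z.2.1 / 2), f (y, z.1.2)|
      ≤ C * Real.exp (-c * |z.1.2|) * expMass c z.1.1 z.2.1 := by
    rw [expMass, ← integral_const_mul]
    refine (abs_integral_le_integral_abs).trans ?_
    refine setIntegral_mono (hf.integrableOn_line _ _ _).abs (hi.const_mul _).integrableOn
      fun y => ?_
    refine (h _).trans (le_of_eq ?_)
    simp only
    rw [mul_assoc, ← Real.exp_add]
    ring_nf
  have h2 : Real.exp (-c * |z.1.2|) ≤ (1 + 1 / c + expTotal c) / (1 + |z.1.2|) := by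
    rw [le_div_iff₀ (by positivity), mul_comm]
    have := one_add_abs_mul_exp_le hc z.1.2
    linarith [expTotal_nonneg c]
  have h3 := expMass_nonneg c z.1.1 z.2.1
  rw [hf.lineKernel_eq, abs_mul, abs_of_nonneg hz]
  calc z.2.2 * |∫ y in Icc (z.1.1 - z.2.1 / 2) (z.1.1 + z.2.1 / 2), f (y, z.1.2)|
      ≤ z.2.2 * (C * ((1 + 1 / c + expTotal c) / (1 + |z.1.2|)) * expMass c z.1.1 z.2.1) := by
        gcongr
        refine h1.trans ?_
        gcongr
    _ = _ := by ring

/-- A function that dominates the rescaled masses of thin boxes. -/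
def lineBound (C c : ℝ) (z : BoxSpace) : ℝ :=
  C * (expMass c z.1.1 z.2.1 * (z.2.2 * ((1 + 1 / c + expTotal c) / (1 + |z.1.2|))))

theorem measurable_lineBound (C c : ℝ) : Measurable (lineBound C c) := by
  have := (measurable_expMass c).comp
    (show Measurable fun z : BoxSpace => (z.1.1, z.2.1) by fun_prop)
  refine (this.mul ?_).const_mul C
  fun_prop

/-- The maximal bound in the short direction yields a factor $\rho u_2$, whose $\rho$ cancels the
normalisation. The majorant is therefore uniform in $\rho$. -/
theorem abs_apply_thin_box_div_le (hf : IsLineDensity μ f) {C c : ℝ} (hC : 0 < C) (hc : 0 < c)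
    (h : ∀ x : ℝ × ℝ, |f x| ≤ C * Real.exp (-c * (|x.1| + |x.2|))) {ρ : ℝ} (hρ : 0 < ρ)
    {z : BoxSpace} (hz : 0 ≤ z.2.2) :
    |μ (box z.1 (z.2.1, ρ * z.2.2)) / ρ| ≤ lineBound C c z := by
  rw [abs_div, abs_of_pos hρ, div_le_iff₀ hρ]
  refine (abs_apply_box_le hf hc h _ _).trans ?_
  have h1 := expMass_le_maximal hc z.1.2 (mul_nonneg hρ.le hz)
  have h2 := expMass_nonneg c z.1.1 z.2.1
  calc C * (expMass c z.1.1 z.2.1 * expMass c z.1.2 (ρ * z.2.2))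
      ≤ C * (expMass c z.1.1 z.2.1
        * (ρ * z.2.2 * ((1 + 1 / c + expTotal c) / (1 + |z.1.2|)))) := by gcongr
    _ = _ := by
      rw [lineBound]
      ring

/-- The thin-box condition taken at $\varepsilon=\rho u_2$; the factor $u_2$ of the kernel arises
from dividing by $\rho$ instead of $\varepsilon$. -/
theorem tendsto_apply_thin_box_div (hf : IsLineDensity μ f) {ι : Type*} {l : Filter ι}
    {ρ : ι → ℝ} (hρ : Tendsto ρ l (𝓝[>] 0)) {z : BoxSpace} (h1 : 0 < z.2.1) (h2 : 0 < z.2.2) :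
    Tendsto (fun i => μ (box z.1 (z.2.1, ρ i * z.2.2)) / ρ i) l (𝓝 (lineKernel μ z)) := by
  have h3 : Tendsto (fun i => ρ i * z.2.2) l (𝓝[>] 0) := by
    rw [tendsto_nhdsWithin_iff] at hρ ⊢
    refine ⟨by simpa using hρ.1.mul_const z.2.2, ?_⟩
    filter_upwards [hρ.2] with i hi
    exact mul_pos hi h2
  have h4 := ((hf.tendsto_line z.1 z.2.1 h1).comp h3).const_mul z.2.2
  rw [← hf.lineKernel_eq] at h4
  refine h4.congr' ?_
  filter_upwards [(tendsto_nhdsWithin_iff.1 hρ).2] with i hi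
  have hi' : ρ i ≠ 0 := ne_of_gt hi
  have h2' := h2.ne'
  simp only [Function.comp_apply]
  rw [hf.apply_box]
  field_simp

theorem ae_lineIntensity_pos (γ : ℝ) (f₂ : ℝ → ℝ) :
    ∀ᵐ z ∂(lineIntensity γ f₂), 0 < z.2.1 ∧ 0 < z.2.2 := by
  have h1 : ∀ᵐ u ∂((halfLineMeasure fun t => 1 / t ^ (γ + 1)).prod (halfLineMeasure f₂)),
      0 < u.1 ∧ 0 < u.2 := by
    filter_upwards [Measure.quasiMeasurePreserving_fst.ae (ae_halfLineMeasure_pos _),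
      Measure.quasiMeasurePreserving_snd.ae (ae_halfLineMeasure_pos _)] with u h1 h2
    exact ⟨h1, h2⟩
  exact Measure.quasiMeasurePreserving_snd.ae h1

/-- The $p$-th power factors into a part in $(x_1,u_1)$, finite by `lintegral_expMass_rpow_lt_top`,
and a multiple of $(1+|x_2|)^{-p}u_2^p$, finite because $p>1$ and the $p$-th moment of the second
edge is finite. -/
theorem integrable_lineBound_rpow {γ p C c : ℝ} {f₂ : ℝ → ℝ} (hγ : 1 < γ) (hp : γ < p)
    (hC : 0 < C) (hc : 0 < c)
    (hf₂ : ∫⁻ u, ENNReal.ofReal (u ^ p) ∂(halfLineMeasure f₂) < ∞) :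
    Integrable (fun z => |lineBound C c z| ^ p) (lineIntensity γ f₂) := by
  refine ⟨((measurable_lineBound C c).abs.pow_const p).aestronglyMeasurable, ?_⟩
  rw [hasFiniteIntegral_iff_ofReal (ae_of_all _ fun z => by positivity)]
  set K := C * (1 + 1 / c + expTotal c) with hK
  have hE := expTotal_nonneg c
  have hK0 : 0 < K := by positivity
  have hF : Measurable fun q : ℝ × ℝ => ENNReal.ofReal (expMass c q.1 q.2 ^ p) :=
    ((measurable_expMass c).pow_const p).ennreal_ofReal
  have hG : Measurable fun q : ℝ × ℝ => ENNReal.ofReal (K ^ p)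
      * (ENNReal.ofReal ((1 + ‖q.1‖) ^ (-p)) * ENNReal.ofReal (q.2 ^ p)) := by fun_prop
  have e : ∫⁻ z, ENNReal.ofReal (|lineBound C c z| ^ p) ∂(lineIntensity γ f₂)
      = ∫⁻ z, ENNReal.ofReal (expMass c z.1.1 z.2.1 ^ p) * (ENNReal.ofReal (K ^ p)
        * (ENNReal.ofReal ((1 + ‖z.1.2‖) ^ (-p)) * ENNReal.ofReal (z.2.2 ^ p)))
        ∂(lineIntensity γ f₂) := by
    refine lintegral_congr_ae ?_
    filter_upwards [ae_lineIntensity_pos γ f₂] with z hz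
    have h1 := expMass_nonneg c z.1.1 z.2.1
    have h2 := hz.2.le
    have h3 : lineBound C c z = expMass c z.1.1 z.2.1 * (K * ((1 + ‖z.1.2‖)⁻¹ * z.2.2)) := by
      rw [lineBound, hK, Real.norm_eq_abs]
      ring
    rw [h3, abs_of_nonneg (by positivity), Real.mul_rpow h1 (by positivity),
      Real.mul_rpow hK0.le (by positivity), Real.mul_rpow (by positivity) h2,
      Real.inv_rpow (by positivity), ← Real.rpow_neg (by positivity),
      ENNReal.ofReal_mul (by positivity), ENNReal.ofReal_mul (by positivity),
      ENNReal.ofReal_mul (by positivity)]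
  rw [e, lineIntensity, lintegral_mul_boxSpace hF hG]
  refine ENNReal.mul_lt_top (lintegral_expMass_rpow_lt_top hc hγ hp) ?_
  have h4 : ∀ x : ℝ, ∫⁻ u, ENNReal.ofReal (K ^ p)
      * (ENNReal.ofReal ((1 + ‖x‖) ^ (-p)) * ENNReal.ofReal (u ^ p)) ∂(halfLineMeasure f₂)
      = ENNReal.ofReal (K ^ p) * (ENNReal.ofReal ((1 + ‖x‖) ^ (-p))
        * ∫⁻ u, ENNReal.ofReal (u ^ p) ∂(halfLineMeasure f₂)) := fun x => by
    rw [lintegral_const_mul _ (by fun_prop), lintegral_const_mul _ (by fun_prop)]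
  simp_rw [h4]
  rw [lintegral_const_mul _ (by fun_prop), lintegral_mul_const _ (by fun_prop)]
  refine ENNReal.mul_lt_top ENNReal.ofReal_lt_top (ENNReal.mul_lt_top ?_ hf₂)
  exact (integrable_one_add_norm (E := ℝ) (μ := volume) (r := p)
    (by simpa using hγ.trans hp)).lintegral_lt_top

theorem integrable_lineKernel_rpow {γ p : ℝ} {f₂ : ℝ → ℝ} (hμ : μ ∈ lineMeasures) (hγ : 1 < γ)
    (hp : γ < p) (hf₂ : ∫⁻ u, ENNReal.ofReal (u ^ p) ∂(halfLineMeasure f₂) < ∞) :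
    Integrable (fun z => |lineKernel μ z| ^ p) (lineIntensity γ f₂) := by
  have hf := isLineDensity_lineDensity hμ
  obtain ⟨C, hC, c, hc, h⟩ := hf.decay
  refine (integrable_lineBound_rpow hγ hp hC hc hf₂).mono'
    ((measurable_lineKernel hμ).abs.pow_const p).aestronglyMeasurable ?_
  filter_upwards [ae_lineIntensity_pos γ f₂] with z hz
  rw [Real.norm_of_nonneg (by positivity)]
  refine Real.rpow_le_rpow (abs_nonneg _) ?_ (by linarith)
  exact (abs_lineKernel_le hf hC hc h hz.2.le).trans (le_abs_self _)

end LineDensity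

end

end RandomBoxes

namespace RandomBoxes

noncomputable section

/-! ### The intensity of the scaled model -/

instance instSFiniteEdgeMeasure (f₁ f₂ : ℝ → ℝ) : SFinite (edgeMeasure f₁ f₂) := by
  unfold edgeMeasure
  infer_instance

instance instSFiniteScaledEdgeMeasure (f₁ f₂ : ℝ → ℝ) (ρ : ℝ) :
    SFinite (scaledEdgeMeasure f₁ f₂ ρ) := by
  unfold scaledEdgeMeasure
  infer_instance

/-- The density of the scaled first edge length, relative to its limit. -/
def edgeRatio (f₁ : ℝ → ℝ) (γ l ρ v : ℝ) : ℝ := l * f₁ (v / ρ) / ρ * v ^ (γ + 1)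

/-- Separates the two quantities with known limits: $\lambda\rho^\gamma$, and $f_1(t)t^{\gamma+1}$
at $t=v/\rho\to\infty$. -/
theorem edgeRatio_eq (f₁ : ℝ → ℝ) {γ l ρ v : ℝ} (hρ : 0 < ρ) (hv : 0 < v) :
    edgeRatio f₁ γ l ρ v = l * ρ ^ γ * (f₁ (v / ρ) * (v / ρ) ^ (γ + 1)) := by
  have h1 : 0 < ρ ^ γ := Real.rpow_pos_of_pos hρ _
  rw [edgeRatio, Real.div_rpow hv.le hρ.le, Real.rpow_add_one hρ.ne']
  field_simp

theorem measurable_edgeRatio {f₁ : ℝ → ℝ} (hf₁ : Measurable f₁) (γ l ρ : ℝ) :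
    Measurable (edgeRatio f₁ γ l ρ) := by
  unfold edgeRatio
  fun_prop

theorem lintegral_edgeRatio {f₁ : ℝ → ℝ} (hf₁ : Measurable f₁) (γ : ℝ) {l ρ : ℝ} (hl : 0 ≤ l)
    (hρ : 0 < ρ) {g : ℝ → ℝ≥0∞} (hg : Measurable g) :
    ENNReal.ofReal l * ∫⁻ u, g (ρ * u) ∂(halfLineMeasure f₁)
      = ∫⁻ v, ENNReal.ofReal (edgeRatio f₁ γ l ρ v) * g v
        ∂(halfLineMeasure fun t => 1 / t ^ (γ + 1)) := by
  have himg : Ioi (0 : ℝ) = (fun u => ρ * u) '' Ioi 0 := by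
    rw [image_mul_left_Ioi hρ, mul_zero]
  have hr := measurable_edgeRatio hf₁ γ l ρ
  rw [lintegral_halfLineMeasure hf₁ (by fun_prop), lintegral_halfLineMeasure (by fun_prop)
    (by fun_prop)]
  conv_rhs => rw [himg]
  rw [lintegral_image_eq_lintegral_abs_deriv_mul measurableSet_Ioi
    (fun u _ => ((hasDerivAt_id' u).const_mul ρ).hasDerivWithinAt)
    (fun a _ b _ h => mul_left_cancel₀ hρ.ne' h), ← lintegral_const_mul _ (by fun_prop)]
  refine setLIntegral_congr_fun measurableSet_Ioi fun u hu => ?_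
  have hu' : 0 < u := hu
  have h1 : 0 < (ρ * u) ^ (γ + 1) := Real.rpow_pos_of_pos (by positivity) _
  simp only [mul_one]
  rw [abs_of_pos hρ, ← mul_assoc, ← mul_assoc, ← mul_assoc, ← ENNReal.ofReal_mul hl,
    ← ENNReal.ofReal_mul hρ.le, ← ENNReal.ofReal_mul (by positivity)]
  congr 2
  rw [edgeRatio, mul_div_cancel_left₀ u hρ.ne']
  field_simp

/-- Puts all the scaled models on the fixed measure $n_L$, so that dominated convergence applies.
The scaling of the first edge is absorbed into a density, that of the second into the integrand. -/
theorem boxIntensity_eq_map {f₁ f₂ : ℝ → ℝ} (hf₁ : Measurable f₁) (γ : ℝ) {l ρ : ℝ} (hl : 0 ≤ l)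
    (hρ : 0 < ρ) :
    boxIntensity f₁ f₂ l ρ = ((lineIntensity γ f₂).withDensity
      fun z => ENNReal.ofReal (edgeRatio f₁ γ l ρ z.2.1)).map
        fun z => (z.1, (z.2.1, ρ * z.2.2)) := by
  have hr := measurable_edgeRatio hf₁ γ l ρ
  refine Measure.ext_of_lintegral _ fun G hG => ?_
  rw [lintegral_map hG (by fun_prop), lintegral_withDensity_eq_lintegral_mul _ (by fun_prop)
    (by fun_prop), boxIntensity, lintegral_smul_measure, lineIntensity,
    lintegral_prod _ hG.aemeasurable, lintegral_prod _ (by fun_prop), smul_eq_mul,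
    ← lintegral_const_mul _ hG.lintegral_prod_right']
  refine lintegral_congr fun x => ?_
  have hg : Measurable fun v => ∫⁻ u₂, G (x, (v, ρ * u₂)) ∂(halfLineMeasure f₂) :=
    (show Measurable fun q : ℝ × ℝ => G (x, (q.1, ρ * q.2)) by fun_prop).lintegral_prod_right'
  rw [scaledEdgeMeasure, lintegral_map (by fun_prop) (by fun_prop), edgeMeasure,
    lintegral_prod _ (by fun_prop), lintegral_prod _ (by fun_prop),
    lintegral_edgeRatio hf₁ γ hl hρ hg]
  refine lintegral_congr fun v => ?_
  simp only [Pi.mul_apply]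
  rw [lintegral_const_mul _ (by fun_prop)]

theorem integral_boxIntensity {f₁ f₂ : ℝ → ℝ} (hf₁ : Measurable f₁) (γ : ℝ) {l ρ : ℝ} (hl : 0 ≤ l)
    (hρ : 0 < ρ) {G : BoxSpace → ℂ} (hG : Measurable G) :
    ∫ z, G z ∂(boxIntensity f₁ f₂ l ρ)
      = ∫ z, (ENNReal.ofReal (edgeRatio f₁ γ l ρ z.2.1)).toReal • G (z.1, (z.2.1, ρ * z.2.2))
        ∂(lineIntensity γ f₂) := by
  have hr := measurable_edgeRatio hf₁ γ l ρ
  rw [boxIntensity_eq_map hf₁ γ hl hρ, integral_map (by fun_prop) hG.aestronglyMeasurable,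
    integral_withDensity_eq_integral_toReal_smul (by fun_prop)
      (ae_of_all _ fun z => ENNReal.ofReal_lt_top)]

theorem tendsto_edgeRatio {f₁ : ℝ → ℝ} {γ : ℝ} (hf₁ : f₁ ~[atTop] fun u => 1 / u ^ (γ + 1))
    {ι : Type*} {F : Filter ι} {l ρ : ι → ℝ} (hρ : Tendsto ρ F (𝓝[>] 0))
    (hl : Tendsto (fun i => l i * ρ i ^ γ) F (𝓝 1)) {v : ℝ} (hv : 0 < v) :
    Tendsto (fun i => edgeRatio f₁ γ (l i) (ρ i) v) F (𝓝 1) := by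
  have h1 : Tendsto (fun u : ℝ => f₁ u * u ^ (γ + 1)) atTop (𝓝 1) := by
    have h2 := (Asymptotics.isEquivalent_iff_tendsto_one (by
      filter_upwards [eventually_gt_atTop 0] with u hu
      have := Real.rpow_pos_of_pos hu (γ + 1)
      positivity)).1 hf₁
    refine h2.congr fun u => ?_
    simp
  have h3 : Tendsto (fun i => v / ρ i) F atTop := by
    simp_rw [div_eq_mul_inv]
    exact (tendsto_inv_nhdsGT_zero.comp hρ).const_mul_atTop hv
  have h4 := hl.mul (h1.comp h3)
  rw [mul_one] at h4
  refine h4.congr' ?_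
  filter_upwards [(tendsto_nhdsWithin_iff.1 hρ).2] with i hi
  exact (edgeRatio_eq f₁ hi hv).symm

theorem edgeRatio_le {f₁ : ℝ → ℝ} {γ l ρ v c : ℝ} (hf₁ : ∀ u, 0 < u → f₁ u ≤ c / u ^ (γ + 1))
    (hc : 0 < c) (hρ : 0 < ρ) (hv : 0 < v) (hl : 0 ≤ l) (hb : l * ρ ^ γ ≤ 2) :
    edgeRatio f₁ γ l ρ v ≤ 2 * c := by
  have h0 : 0 < v / ρ := by positivity
  have h1 := hf₁ _ h0
  have h2 : 0 < (v / ρ) ^ (γ + 1) := Real.rpow_pos_of_pos h0 _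
  rw [le_div_iff₀ h2] at h1
  have h3 : 0 ≤ l * ρ ^ γ := mul_nonneg hl (Real.rpow_nonneg hρ.le _)
  rw [edgeRatio_eq f₁ hρ hv]
  calc l * ρ ^ γ * (f₁ (v / ρ) * (v / ρ) ^ (γ + 1)) ≤ l * ρ ^ γ * c := by gcongr
    _ ≤ 2 * c := by gcongr

/-- The two masses have product 1; an infinite factor would make the product $\infty$, or $0$ if the
other factor vanishes. -/
theorem isFiniteMeasure_halfLineMeasure_of_edgeMeasure {f₁ f₂ : ℝ → ℝ}
    (hF : IsProbabilityMeasure (edgeMeasure f₁ f₂)) :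
    halfLineMeasure f₁ univ < ∞ ∧ halfLineMeasure f₂ univ < ∞ := by
  have h := hF.measure_univ
  rw [edgeMeasure, ← univ_prod_univ, Measure.prod_prod] at h
  refine ⟨lt_top_iff_ne_top.2 fun h1 => ?_, lt_top_iff_ne_top.2 fun h2 => ?_⟩
  · rw [h1] at h
    by_cases h0 : halfLineMeasure f₂ univ = 0
    · simp [h0] at h
    · simp [ENNReal.top_mul h0] at h
  · rw [h2] at h
    by_cases h0 : halfLineMeasure f₁ univ = 0
    · simp [h0] at h
    · simp [ENNReal.mul_top h0] at h

theorem integrable_apply_box {f₁ f₂ : ℝ → ℝ}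
    (h₁ : ∫⁻ u, ENNReal.ofReal u ∂(halfLineMeasure f₁) < ∞)
    (h₂ : ∫⁻ u, ENNReal.ofReal u ∂(halfLineMeasure f₂) < ∞) (l : ℝ) {ρ : ℝ} (hρ : 0 < ρ)
    {μ : SignedMeasure (ℝ × ℝ)} (hμ : μ ∈ lineMeasures) :
    Integrable (fun z : BoxSpace => μ (box z.1 z.2)) (boxIntensity f₁ f₂ l ρ) := by
  have hf := isLineDensity_lineDensity hμ
  obtain ⟨C, hC, c, hc, h⟩ := hf.decay
  refine Integrable.smul_measure ?_ ENNReal.ofReal_ne_top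
  refine ⟨(measurable_apply_box hμ).aestronglyMeasurable, ?_⟩
  have hA := (measurable_expMass c).ennreal_ofReal
  have e : scaledEdgeMeasure f₁ f₂ ρ = ((halfLineMeasure f₁).map fun u => ρ * u).prod
      ((halfLineMeasure f₂).map fun u => ρ * u) := by
    rw [Measure.map_prod_map _ _ (by fun_prop) (by fun_prop)]
    rfl
  rw [hasFiniteIntegral_iff_enorm, e]
  have hle : ∀ z : BoxSpace, ‖μ (box z.1 z.2)‖ₑ ≤ ENNReal.ofReal C *
      (ENNReal.ofReal (expMass c z.1.1 z.2.1) * ENNReal.ofReal (expMass c z.1.2 z.2.2)) := fun z => by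
    rw [← ENNReal.ofReal_mul (expMass_nonneg _ _ _), ← ENNReal.ofReal_mul hC.le,
      Real.enorm_eq_ofReal_abs]
    exact ENNReal.ofReal_le_ofReal (abs_apply_box_le hf hc h _ _)
  refine (lintegral_mono hle).trans_lt ?_
  have hAA : Measurable fun z : BoxSpace => ENNReal.ofReal (expMass c z.1.1 z.2.1)
      * ENNReal.ofReal (expMass c z.1.2 z.2.2) :=
    (hA.comp (show Measurable fun z : BoxSpace => (z.1.1, z.2.1) by fun_prop)).mul
      (hA.comp (show Measurable fun z : BoxSpace => (z.1.2, z.2.2) by fun_prop))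
  rw [lintegral_const_mul _ hAA, lintegral_mul_boxSpace
    (F := fun q => ENNReal.ofReal (expMass c q.1 q.2))
    (G := fun q => ENNReal.ofReal (expMass c q.1 q.2)) hA hA]
  exact ENNReal.mul_lt_top ENNReal.ofReal_lt_top (ENNReal.mul_lt_top
    (lintegral_expMass_halfLineMeasure_lt_top hc hρ h₁)
    (lintegral_expMass_halfLineMeasure_lt_top hc hρ h₂))

/-- Convergence of the Lévy exponents of the rescaled fields. -/
theorem tendsto_integral_levyKernel_boxIntensity {f₁ f₂ : ℝ → ℝ} {γ p : ℝ} (hγ : 1 < γ)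
    (hγp : γ < p) (hp : p ≤ 2) (hf₁m : Measurable f₁)
    (hf₁ : f₁ ~[atTop] fun u => 1 / u ^ (γ + 1))
    (hf₁b : ∃ c > 0, ∀ u, 0 < u → f₁ u ≤ c / u ^ (γ + 1))
    (hf₂ : ∫⁻ u, ENNReal.ofReal (u ^ p) ∂(halfLineMeasure f₂) < ∞)
    {ι : Type*} {F : Filter ι} [F.IsCountablyGenerated] {l ρ : ι → ℝ} (hl0 : ∀ i, 0 ≤ l i)
    (hρ0 : ∀ i, 0 < ρ i) (hρ : Tendsto ρ F (𝓝[>] 0))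
    (hl : Tendsto (fun i => l i * ρ i ^ γ) F (𝓝 1))
    {μ : SignedMeasure (ℝ × ℝ)} (hμ : μ ∈ lineMeasures) (t : ℝ) :
    Tendsto (fun i => ∫ z : BoxSpace, levyKernel (t * (μ (box z.1 z.2) / ρ i))
        ∂(boxIntensity f₁ f₂ (l i) (ρ i))) F
      (𝓝 (∫ z, levyKernel (t * lineKernel μ z) ∂(lineIntensity γ f₂))) := by
  have hf := isLineDensity_lineDensity hμ
  obtain ⟨C, hC, c, hc, h⟩ := hf.decay
  obtain ⟨b, hb, hfb⟩ := hf₁b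
  have hbox := measurable_apply_box hμ
  have hlev := continuous_levyKernel.measurable
  have hr := fun i => measurable_edgeRatio hf₁m γ (l i) (ρ i)
  have hm : ∀ i, Measurable fun z : BoxSpace => levyKernel (t * (μ (box z.1 z.2) / ρ i)) :=
    fun i => hlev.comp ((hbox.div_const _).const_mul t)
  simp only [fun i => integral_boxIntensity (f₂ := f₂) hf₁m γ (hl0 i) (hρ0 i) (hm i)]
  refine tendsto_integral_filter_of_dominated_convergence
    -- The factor $2b$ bounds the density ratio once $\lambda\rho^\gamma\le2$; the rest is the bound
    -- $2|x|^p$ on the Lévy kernel.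
    (fun z => 2 * b * (2 * (|t| ^ p * |lineBound C c z| ^ p))) (Eventually.of_forall fun i => ?_)
    ?_ ((((integrable_lineBound_rpow hγ hγp hC hc hf₂).const_mul _).const_mul _).const_mul _) ?_
  · have h1 : Measurable fun z : BoxSpace =>
        (ENNReal.ofReal (edgeRatio f₁ γ (l i) (ρ i) z.2.1)).toReal := by
      have := hr i
      fun_prop
    have h2 := (hm i).comp
      (show Measurable fun z : BoxSpace => (z.1, (z.2.1, ρ i * z.2.2)) by fun_prop)
    exact (h1.smul h2).aestronglyMeasurable
  · filter_upwards [hl.eventually_le_const one_lt_two] with i hi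
    filter_upwards [ae_lineIntensity_pos γ f₂] with z hz
    rw [norm_smul, Real.norm_of_nonneg ENNReal.toReal_nonneg]
    gcongr
    · exact ENNReal.toReal_le_of_le_ofReal (by positivity) (ENNReal.ofReal_le_ofReal
        (edgeRatio_le hfb hb (hρ0 i) hz.1 (hl0 i) hi))
    · refine (norm_levyKernel_le (by linarith) hp _).trans ?_
      rw [abs_mul, Real.mul_rpow (abs_nonneg _) (abs_nonneg _)]
      have := (abs_apply_thin_box_div_le hf hC hc h (hρ0 i) hz.2.le).trans (le_abs_self _)
      have hp0 : 0 ≤ p := by linarith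
      gcongr
  · filter_upwards [ae_lineIntensity_pos γ f₂] with z hz
    have h1 : Tendsto (fun i => (ENNReal.ofReal (edgeRatio f₁ γ (l i) (ρ i) z.2.1)).toReal) F
        (𝓝 1) := by
      have := (ENNReal.tendsto_toReal ENNReal.ofReal_ne_top).comp
        (ENNReal.tendsto_ofReal (tendsto_edgeRatio hf₁ hρ hl hz.1))
      rwa [ENNReal.toReal_ofReal zero_le_one] at this
    have h2 := h1.smul ((continuous_levyKernel.tendsto _).comp
      ((tendsto_apply_thin_box_div hf hρ hz.1 hz.2).const_mul t))
    simpa using h2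

/-! ### Convergence of finite-dimensional distributions -/

/-- The norm of `Fin m → ℝ` comes from no inner product, so characteristic functions of vectors are
taken in Euclidean space; each is that of a linear combination at frequency 1. -/
theorem charFun_map_toLp {Ω : Type*} [MeasurableSpace Ω] {P : Measure Ω} {m : ℕ}
    {Y : Ω → Fin m → ℝ} (hY : AEMeasurable Y P) (t : EuclideanSpace ℝ (Fin m)) :
    charFun (P.map fun ω => WithLp.toLp 2 (Y ω)) t
      = charFun (P.map fun ω => ∑ j, t j * Y ω j) 1 := by
  have hto : Measurable (fun x : Fin m → ℝ => WithLp.toLp 2 x) := by fun_prop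
  have hYt : AEMeasurable (fun ω => WithLp.toLp 2 (Y ω)) P := hto.comp_aemeasurable hY
  rw [charFun_map_one (by fun_prop), charFun_apply, integral_map hYt (by fun_prop)]
  refine integral_congr_ae (ae_of_all _ fun ω => ?_)
  simp only [PiLp.inner_apply, one_mul]
  rfl

/-- Convergence in distribution of random vectors, by characteristic functions of linear
combinations of their components. -/
theorem tendstoInDistribution_pi_of_tendsto_charFun {ι : Type*} {Ω : ι → Type*}
    [∀ i, MeasurableSpace (Ω i)] {P : ∀ i, Measure (Ω i)} [∀ i, IsProbabilityMeasure (P i)]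
    {Ω' : Type*} [MeasurableSpace Ω'] {P' : Measure Ω'} [IsProbabilityMeasure P'] {m : ℕ}
    {X : ∀ i, Ω i → Fin m → ℝ} {Z : Ω' → Fin m → ℝ} {F : Filter ι} [F.IsCountablyGenerated]
    (hX : ∀ i, AEMeasurable (X i) (P i)) (hZ : AEMeasurable Z P')
    (h : ∀ t : Fin m → ℝ,
      Tendsto (fun i => charFun ((P i).map fun ω => ∑ j, t j * X i ω j) 1) F
        (𝓝 (charFun (P'.map fun ω => ∑ j, t j * Z ω j) 1))) :
    TendstoInDistribution X F Z P P' := by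
  have hto : Measurable (fun x : Fin m → ℝ => WithLp.toLp 2 x) := by fun_prop
  have hE : TendstoInDistribution (fun i ω => WithLp.toLp 2 (X i ω)) F
      (fun ω => WithLp.toLp 2 (Z ω)) P P' := by
    refine ⟨fun i => hto.comp_aemeasurable (hX i), hto.comp_aemeasurable hZ, ?_⟩
    -- The continuity theorem is applied along sequences, which suffices because the filter is
    -- countably generated.
    refine tendsto_of_seq_tendsto fun u hu =>
      ProbabilityMeasure.tendsto_of_tendsto_charFun fun t => ?_
    change Tendsto (fun n => charFun ((P (u n)).map fun ω => WithLp.toLp 2 (X (u n) ω)) t) atTop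
      (𝓝 (charFun (P'.map fun ω => WithLp.toLp 2 (Z ω)) t))
    simp only [charFun_map_toLp (hX _), charFun_map_toLp hZ]
    exact (h t).comp hu
  exact hE.continuous_comp (g := fun x : EuclideanSpace ℝ (Fin m) => WithLp.ofLp x)
    (by fun_prop)

end

end RandomBoxes

namespace RandomBoxes

/-! ### The fields -/

section Fields

theorem sum_smul_mem_lineMeasures {ι : Type*} (s : Finset ι) {μ : ι → SignedMeasure (ℝ × ℝ)}
    (hμ : ∀ i, μ i ∈ lineMeasures) (t : ι → ℝ) : ∑ i ∈ s, t i • μ i ∈ lineMeasures := by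
  classical
  induction s using Finset.induction with
  | empty => simpa using zero_mem_lineMeasures
  | insert i s hi ih =>
    rw [Finset.sum_insert hi]
    simpa using linear_comb_mem_lineMeasures (hμ i) ih (t i) 1

theorem sum_smul_apply {ι : Type*} (s : Finset ι) (μ : ι → SignedMeasure (ℝ × ℝ)) (t : ι → ℝ)
    (A : Set (ℝ × ℝ)) : (∑ i ∈ s, t i • μ i) A = ∑ i ∈ s, t i * μ i A := by
  classical
  induction s using Finset.induction with
  | empty => simp
  | insert i s hi ih => rw [Finset.sum_insert hi, Finset.sum_insert hi, ← ih]; rfl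

variable {Ω : Type*} [MeasurableSpace Ω] {P : Measure Ω} {N : Ω → Measure BoxSpace}

/-- Campbell's formula turns the expectation into an integral against $n$, so centring is
compensation. The identity is only almost sure because additivity of the random integrals needs
integrability under $N(\omega)$. -/
theorem sum_centredBoxField_div_ae_eq {n : Measure BoxSpace} (hN : IsPoissonRandomMeasure N n P)
    {m : ℕ} {μ : Fin m → SignedMeasure (ℝ × ℝ)} (hμ : ∀ i, μ i ∈ lineMeasures)
    (hint : ∀ i, Integrable (fun z : BoxSpace => μ i (box z.1 z.2)) n) (t : Fin m → ℝ) (ρ : ℝ) :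
    (fun ω => ∑ i, t i * (centredBoxField P N (μ i) ω / ρ)) =ᵐ[P]
      fun ω => ∫ z, (∑ i, t i • μ i) (box z.1 z.2) / ρ ∂(N ω)
        - ∫ z, (∑ i, t i • μ i) (box z.1 z.2) / ρ ∂n := by
  have h1 : ∀ᵐ ω ∂P, ∀ i, Integrable (fun z : BoxSpace => μ i (box z.1 z.2)) (N ω) :=
    ae_all_iff.2 fun i => hN.ae_integrable (measurable_apply_box (hμ i)) (hint i)
  filter_upwards [h1] with ω hω
  simp only [integral_div, sum_smul_apply]
  rw [integral_finsetSum _ fun i _ => (hω i).const_mul _,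
    integral_finsetSum _ fun i _ => (hint i).const_mul _, ← sub_div, ← Finset.sum_sub_distrib,
    Finset.sum_div]
  refine Finset.sum_congr rfl fun i _ => ?_
  rw [integral_const_mul, integral_const_mul, centredBoxField]
  simp only [boxField]
  rw [hN.integral_integral (measurable_apply_box (hμ i)) (hint i)]
  ring

variable [IsProbabilityMeasure P] {γ p : ℝ} {f₂ : ℝ → ℝ}

theorem isCompensatedIntegral_lineField (hN : IsPoissonRandomMeasure N (lineIntensity γ f₂) P)
    (hγ : 1 < γ) (hγp : γ < p) (hp : p ≤ 2)
    (hf₂ : ∫⁻ u, ENNReal.ofReal (u ^ p) ∂(halfLineMeasure f₂) < ∞)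
    {μ : SignedMeasure (ℝ × ℝ)} (hμ : μ ∈ lineMeasures) :
    IsCompensatedIntegral N (lineIntensity γ f₂) P (lineKernel μ) (lineField γ f₂ P N μ) :=
  hN.isCompensatedIntegral_compensatedIntegral (hγ.trans hγp).le hp (measurable_lineKernel hμ)
    (integrable_lineKernel_rpow hμ hγ hγp hf₂)

theorem lineField_linear_comb_ae_eq (hN : IsPoissonRandomMeasure N (lineIntensity γ f₂) P)
    (hγ : 1 < γ) (hγp : γ < p) (hp : p ≤ 2)
    (hf₂ : ∫⁻ u, ENNReal.ofReal (u ^ p) ∂(halfLineMeasure f₂) < ∞)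
    {μ ν : SignedMeasure (ℝ × ℝ)} (hμ : μ ∈ lineMeasures) (hν : ν ∈ lineMeasures) (a b : ℝ) :
    lineField γ f₂ P N (a • μ + b • ν) =ᵐ[P]
      fun ω => a * lineField γ f₂ P N μ ω + b * lineField γ f₂ P N ν ω := by
  have hmem := linear_comb_mem_lineMeasures hμ hν a b
  have h1 := isCompensatedIntegral_lineField hN hγ hγp hp hf₂ hmem
  have h2 := integrable_lineKernel_rpow hmem hγ hγp hf₂
  rw [lineKernel_linear_comb hμ hν] at h1 h2
  exact IsCompensatedIntegral.linear_comb_ae_eq hN (hγ.trans hγp).le hp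
    (isCompensatedIntegral_lineField hN hγ hγp hp hf₂ hμ)
    (isCompensatedIntegral_lineField hN hγ hγp hp hf₂ hν)
    (integrable_lineKernel_rpow hμ hγ hγp hf₂) (integrable_lineKernel_rpow hν hγ hγp hf₂) h1 h2

theorem lineField_sum_smul_ae_eq (hN : IsPoissonRandomMeasure N (lineIntensity γ f₂) P)
    (hγ : 1 < γ) (hγp : γ < p) (hp : p ≤ 2)
    (hf₂ : ∫⁻ u, ENNReal.ofReal (u ^ p) ∂(halfLineMeasure f₂) < ∞) {ι : Type*} (s : Finset ι)
    {μ : ι → SignedMeasure (ℝ × ℝ)} (hμ : ∀ i, μ i ∈ lineMeasures) (t : ι → ℝ) :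
    lineField γ f₂ P N (∑ i ∈ s, t i • μ i) =ᵐ[P]
      fun ω => ∑ i ∈ s, t i * lineField γ f₂ P N (μ i) ω := by
  classical
  induction s using Finset.induction with
  | empty =>
    -- The field at the zero measure is a chosen version, so its almost sure vanishing is obtained
    -- from linearity with both coefficients $0$.
    have h := lineField_linear_comb_ae_eq hN hγ hγp hp hf₂ zero_mem_lineMeasures
      zero_mem_lineMeasures 0 0
    simpa using h
  | insert i s hi ih =>
    have h := lineField_linear_comb_ae_eq hN hγ hγp hp hf₂ (hμ i)
      (sum_smul_mem_lineMeasures s hμ t) (t i) 1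
    rw [one_smul] at h
    rw [Finset.sum_insert hi]
    filter_upwards [h, ih] with ω h1 h2
    rw [h1, h2, Finset.sum_insert hi, one_mul]

end Fields

end RandomBoxes

/-! ### The scaling limit -/

theorem mainTheorem4
    (γ₁ γ₂ : ℝ) (hγ₁ : 1 < γ₁) (hγ₁' : γ₁ < 2) (hγ : γ₁ < γ₂)
    -- the edge length densities
    (f₁ f₂ : ℝ → ℝ) (hf₁m : Measurable f₁) (hf₂m : Measurable f₂)
    (hf₁0 : ∀ u, 0 < u → 0 ≤ f₁ u) (hf₂0 : ∀ u, 0 < u → 0 ≤ f₂ u)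
    (hF : IsProbabilityMeasure (edgeMeasure f₁ f₂))
    (hf₁ : f₁ ~[atTop] fun u => 1 / u ^ (γ₁ + 1))
    (hf₂ : f₂ ~[atTop] fun u => 1 / u ^ (γ₂ + 1))
    (hf₁b : ∃ c > 0, ∀ u, 0 < u → f₁ u ≤ c / u ^ (γ₁ + 1))
    -- the intensity, as a function of the scaling parameter
    (lam : Ioi (0 : ℝ) → ℝ) (hlam0 : ∀ ρ, 0 < lam ρ)
    (hlam : Tendsto (fun ρ : Ioi (0 : ℝ) => lam ρ * (ρ : ℝ) ^ γ₁)
      (comap ((↑) : Ioi (0 : ℝ) → ℝ) (𝓝 0)) (𝓝 1))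
    -- the Poisson random measures of the scaled models
    {Ω : Ioi (0 : ℝ) → Type*} [∀ ρ, MeasurableSpace (Ω ρ)]
    (P : ∀ ρ, Measure (Ω ρ)) [∀ ρ, IsProbabilityMeasure (P ρ)]
    (N : ∀ ρ, Ω ρ → Measure BoxSpace)
    (hN : ∀ ρ, IsPoissonRandomMeasure (N ρ) (boxIntensity f₁ f₂ (lam ρ) (ρ : ℝ)) (P ρ))
    -- the Poisson random measure that drives the limiting field
    {ΩL : Type*} [MeasurableSpace ΩL] (PL : Measure ΩL) [IsProbabilityMeasure PL]
    (NL : ΩL → Measure BoxSpace)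
    (hNL : IsPoissonRandomMeasure NL (lineIntensity γ₁ f₂) PL) :
    -- the prelimit fields are well defined
    (∀ ρ, ∀ μ ∈ lineMeasures,
      (∀ᵐ ω ∂(P ρ), Integrable (fun z : BoxSpace => μ (box z.1 z.2)) (N ρ ω)) ∧
        Integrable (boxField (N ρ) μ) (P ρ)) ∧
    -- the limiting field consists of well-defined compensated Poisson integrals, and is linear
    (∀ μ ∈ lineMeasures, IsCompensatedIntegral NL (lineIntensity γ₁ f₂) PL (lineKernel μ)
      (lineField γ₁ f₂ PL NL μ)) ∧
    (∀ μ ∈ lineMeasures, ∀ ν ∈ lineMeasures, ∀ a b : ℝ, a • μ + b • ν ∈ lineMeasures ∧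
      lineField γ₁ f₂ PL NL (a • μ + b • ν) =ᵐ[PL]
        fun ω => a * lineField γ₁ f₂ PL NL μ ω + b * lineField γ₁ f₂ PL NL ν ω) ∧
    -- convergence of the finite-dimensional distributions
    (∀ (m : ℕ) (μ : Fin m → SignedMeasure (ℝ × ℝ)), (∀ i, μ i ∈ lineMeasures) →
      TendstoInDistribution
        (fun (ρ : Ioi (0 : ℝ)) (ω : Ω ρ) (i : Fin m) =>
          centredBoxField (P ρ) (N ρ) (μ i) ω / (ρ : ℝ))
        (comap ((↑) : Ioi (0 : ℝ) → ℝ) (𝓝 0))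
        (fun ω i => lineField γ₁ f₂ PL NL (μ i) ω) P PL) := by
  -- One exponent serves throughout: $p>\gamma_1$ for small first edges, $p<2$ for the Lévy kernel
  -- bound, $p<\gamma_2$ for the moment of the second edge.
  obtain ⟨p, hp₁, hp'⟩ := exists_between (lt_min hγ₁' hγ)
  have hp₂ : p ≤ 2 := (hp'.trans_le (min_le_left _ _)).le
  have hpγ₂ : p < γ₂ := hp'.trans_le (min_le_right _ _)
  obtain ⟨hfin₁, hfin₂⟩ := isFiniteMeasure_halfLineMeasure_of_edgeMeasure hF
  have hmom₁ : ∫⁻ u, ENNReal.ofReal u ∂(halfLineMeasure f₁) < ∞ := by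
    simpa using lintegral_rpow_halfLineMeasure_lt_top hf₁m hfin₁ hf₁ zero_le_one hγ₁
  have hmom₂ : ∫⁻ u, ENNReal.ofReal u ∂(halfLineMeasure f₂) < ∞ := by
    simpa using lintegral_rpow_halfLineMeasure_lt_top hf₂m hfin₂ hf₂ zero_le_one (hγ₁.trans hγ)
  have hmom : ∫⁻ u, ENNReal.ofReal (u ^ p) ∂(halfLineMeasure f₂) < ∞ :=
    lintegral_rpow_halfLineMeasure_lt_top hf₂m hfin₂ hf₂ (by linarith) hpγ₂
  have hint : ∀ ρ : Ioi (0 : ℝ), ∀ μ ∈ lineMeasures,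
      Integrable (fun z : BoxSpace => μ (box z.1 z.2)) (boxIntensity f₁ f₂ (lam ρ) ρ) :=
    fun ρ μ hμ => integrable_apply_box hmom₁ hmom₂ _ ρ.2 hμ
  have hfield : ∀ μ ∈ lineMeasures, IsCompensatedIntegral NL (lineIntensity γ₁ f₂) PL
      (lineKernel μ) (lineField γ₁ f₂ PL NL μ) := fun μ hμ =>
    isCompensatedIntegral_lineField hNL hγ₁ hp₁ hp₂ hmom hμ
  refine ⟨fun ρ μ hμ => ⟨(hN ρ).ae_integrable (measurable_apply_box hμ) (hint ρ μ hμ),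
    (hN ρ).integrable_integral (measurable_apply_box hμ) (hint ρ μ hμ)⟩, hfield,
    fun μ hμ ν hν a b => ⟨linear_comb_mem_lineMeasures hμ hν a b,
      lineField_linear_comb_ae_eq hNL hγ₁ hp₁ hp₂ hmom hμ hν a b⟩, fun m μ hμ => ?_⟩
  refine tendstoInDistribution_pi_of_tendsto_charFun (fun ρ => aemeasurable_pi_lambda _ fun i => ?_)
    (aemeasurable_pi_lambda _ fun i => (hfield _ (hμ i)).2.1) fun t => ?_
  · exact (((hN ρ).aemeasurable_integral (measurable_apply_box (hμ i))
      (hint ρ _ (hμ i))).sub_const _).div_const _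
  · have hν : ∑ i, t i • μ i ∈ lineMeasures := sum_smul_mem_lineMeasures _ hμ t
    -- On the positive half-line, the neighbourhoods of $0$ pulled back along the inclusion describe
    -- $\rho\downarrow0$.
    have hρ : Tendsto (Subtype.val : Ioi (0 : ℝ) → ℝ) (comap Subtype.val (𝓝 0)) (𝓝[>] 0) :=
      tendsto_nhdsWithin_iff.2 ⟨tendsto_comap, Eventually.of_forall fun ρ => ρ.2⟩
    rw [← Measure.map_congr (lineField_sum_smul_ae_eq hNL hγ₁ hp₁ hp₂ hmom Finset.univ hμ t),
      (hfield _ hν).charFun_map hNL (hγ₁.trans hp₁).le hp₂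
        (integrable_lineKernel_rpow hν hγ₁ hp₁ hmom)]
    have hpre : ∀ ρ : Ioi (0 : ℝ),
        charFun ((P ρ).map fun ω => ∑ i, t i * (centredBoxField (P ρ) (N ρ) (μ i) ω / (ρ : ℝ))) 1
        = Complex.exp (∫ z : BoxSpace, levyKernel (1 * ((∑ i, t i • μ i) (box z.1 z.2) / (ρ : ℝ)))
          ∂(boxIntensity f₁ f₂ (lam ρ) ρ)) := fun ρ => by
      rw [Measure.map_congr (sum_centredBoxField_div_ae_eq (hN ρ) hμ
        (fun i => hint ρ _ (hμ i)) t ρ)]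
      exact (hN ρ).charFun_map_integral_sub ((measurable_apply_box hν).div_const _)
        ((hint ρ _ hν).div_const _) 1
    simp only [hpre]
    exact (Complex.continuous_exp.tendsto _).comp
      (tendsto_integral_levyKernel_boxIntensity hγ₁ hp₁ hp₂ hf₁m hf₁ hf₁b hmom
        (fun ρ => (hlam0 ρ).le) (fun ρ => ρ.2) hρ hlam hν 1)
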